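/- Let $m,n\ge 1$. Label both the white and the black vertices of the honeycomb lattice by $(X,Y)\in\mathbb Z^2$ ($X$ the column, $Y$ the height); the white vertex $\mathrm w_{X,Y}$ is joined to $\mathrm b_{X,Y}$ by an $a$-edge, to $\mathrm b_{X-1,Y}$ by a $b$-edge and to $\mathrm b_{X,Y-1}$ by a $c$-edge. Thus each column is a vertical zigzag of $a$- and $c$-edges, and $b$-edges join neighbouring columns. Fix arbitrary periodic weights $a_{ij},b_{ij},c_{ij}>0$ ($i\in\mathbb Z/m$, $j\in\mathbb Z/n$) on the three edges at each white vertex with $Y\equiv i \pmod m$, $X\equiv j\pmod n$; column $X$ is of type $j$ if $X\equiv j \pmod n$. Let $K(z,w)$ be the $mn\times mn$ Kasteleyn matrix of the quotient graph (rows: white vertices, columns: black vertices), where $c$-edges and $b$-edges leaving the fundamental domain $\{0\le X<n,\ 0\le Y<m\}$ carry the multipliers $z$ and $w^{-1}$ respectively (equivalently, up to gauge, the coefficients are $a_{ij}$, $b_{ij}w^{-1/n}$, $c_{ij}z^{1/m}$). For a magnetic field $B=(B_x,B_y)\in\mathbb R^2$ put $$K_B^{-1}(\mathrm b,\mathrm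 w)=\iint_{\mathbb T^2} z^{-y}w^{x}\,\bigl[K(e^{B_x}z,e^{B_y}w)^{-1}\bigr]_{\mathrm b,\mathrm w}\,\frac{dz}{2i\pi z}\frac{dw}{2i\pi w},$$ where $(x,y)$ is the lattice vector from the fundamental domain of $\mathrm w$ to that of $\mathrm b$, and, for distinct edges $e_l=(\mathrm w_l,\mathrm b_l)$, $1\le l\le k$, $$\mathbb P_B(e_1,\dots,e_k)=\Bigl(\prod_{l} K_B(\mathrm w_l,\mathrm b_l)\Bigr)\det_{1\le l,l'\le k}\bigl[K_B^{-1}(\mathrm b_l,\mathrm w_{l'})\bigr],$$ where $K_B(\mathrm w,\mathrm b)$ is the weight of the edge, multiplied by $e^{B_x}$ (resp. $e^{-B_y}$) if it is a $c$-edge (resp. $b$-edge) between two different fundamental domains. The Gibbs measure in the field $B$ is the probability measure on dimer configurations (perfect matchings) of the honeycomb lattice under which any distinct edges $e_1,\dots,e_k$ are all present with probability $\mathbb P_B(e_1,\dots,e_k)$. Proposition. Fix $B_x\in\mathbb R$ and a column type $j_0$. If $$B_x<\sum_{i=1}^m\log\frac{a_{ij_0}}{c_{ij_0}},$$ then with probability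 tending to $1$ as $B_y\to+\infty$ (that is, as $t=e^{-B_y}\to0$, the limit in which the $b$-edges are suppressed) the columns of type $j_0$ are filled with $a$-edges. If the reverse strict inequality holds, they are filled with $c$-edges with probability tending to $1$. Here "filled with $a$-edges (resp. $c$-edges) with probability tending to $1$" means: (i) for every finite set $\{e_1,\dots,e_k\}$ of $a$-edges (resp. $c$-edges) of columns of type $j_0$, $\mathbb P_B(e_1,\dots,e_k)\to1$; (ii) in every finite window, the probability under the Gibbs measure that all white vertices of columns of type $j_0$ in the window are matched by $a$-edges (resp. $c$-edges) tends to $1$; (iii) if moreover $B_x\ne\sum_{i}\log(a_{ij}/c_{ij})$ for every column type $j$, the probability under the Gibbs measure that all the columns of type $j_0$ are entirely filled with $a$-edges (resp. $c$-edges) tends to $1$. -/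

import Mathlib

open Filter Topology MeasureTheory

noncomputable section

namespace HoneycombDimer

/-- The three orientations of edges of the honeycomb lattice. -/
inductive EdgeType where
  | a
  | b
  | c
  deriving DecidableEq

/-- Edges of the honeycomb lattice. White vertices and black vertices are both labelled by
`(X, Y) : ℤ × ℤ`, where `X` is the column (strip) and `Y` the height in the column.
Every edge is determined by its white end and its orientation. -/
structure Edge where
  white : ℤ × ℤ
  kind : EdgeType
  deriving DecidableEq

/-- The black end of an edge: the white vertex `(X, Y)` is joined to the black vertices `(X, Y)`
(by an `a`-edge), `(X - 1, Y)` (by a `b`-edge) and `(X, Y - 1)` (by a `c`-edge).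
So a column is a vertical zigzag of alternating `a`- and `c`-edges, and the `b`-edges join
neighbouring columns. -/
def Edge.black (e : Edge) : ℤ × ℤ :=
  match e.kind with
  | .a => e.white
  | .b => (e.white.1 - 1, e.white.2)
  | .c => (e.white.1, e.white.2 - 1)

/-- Dimer configurations (perfect matchings) of the honeycomb lattice: sets of edges such that
every vertex, white or black, is incident with exactly one edge of the set. -/
def DimerConfig : Type :=
  {C : Set Edge // (∀ v : ℤ × ℤ, ∃! e : Edge, e ∈ C ∧ e.white = v) ∧
    (∀ v : ℤ × ℤ, ∃! e : Edge, e ∈ C ∧ e.black = v)}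

/-- The σ-algebra generated by the events `e ∈ C`, for `e` an edge. -/
instance : MeasurableSpace DimerConfig :=
  inferInstanceAs (MeasurableSpace (Subtype _))

section Weights

/- `n` columns and `m` rows in the fundamental domain; `a i j`, `b i j`, `c i j` are the weights of
the edges around the white vertex of row `i` and column `j`. -/
variable {m n : ℕ} (a b c : ZMod m → ZMod n → ℝ)

/-- The row and the column, modulo the lattice of periods, of a vertex. -/
def vertexType (m n : ℕ) (v : ℤ × ℤ) : ZMod m × ZMod n := ((v.2 : ZMod m), (v.1 : ZMod n))

/-- The Kasteleyn matrix `K(z, w)` of the quotient graph: rows are white vertices, columns are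
black vertices. The edges leaving the fundamental domain carry the multipliers: `z` for `c`-edges
and `w⁻¹` for `b`-edges. (Up to a gauge transformation, each `c`-edge carries `z ^ (1 / m)` and
each `b`-edge carries `w ^ (-1 / n)`.) -/
def kasteleyn (z w : ℂ) : Matrix (ZMod m × ZMod n) (ZMod m × ZMod n) ℂ :=
  Matrix.of fun p q =>
    (if q = p then (a p.1 p.2 : ℂ) else 0) +
    (if q = (p.1, p.2 - 1) then (b p.1 p.2 : ℂ) * (if p.2 = 0 then w⁻¹ else 1) else 0) +
    (if q = (p.1 - 1, p.2) then (c p.1 p.2 : ℂ) * (if p.1 = 0 then z else 1) else 0)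

/-- The entry of the Kasteleyn operator of the infinite lattice, in the magnetic field
`(Bx, By)`, between the two ends of an edge. -/
def edgeWeight (Bx By : ℝ) (e : Edge) : ℝ :=
  let i : ZMod m := (vertexType m n e.white).1
  let j : ZMod n := (vertexType m n e.white).2
  match e.kind with
  | .a => a i j
  | .b => b i j * (if j = 0 then Real.exp (-By) else 1)
  | .c => c i j * (if i = 0 then Real.exp Bx else 1)

/-- The inverse Kasteleyn operator in the magnetic field `(Bx, By)`, between a black vertex and a
white vertex, whose fundamental domains are separated by the lattice vector `(x, y)`:
`∬ z ^ (-y) w ^ x [K(e ^ Bx z, e ^ By w)]⁻¹ dz / (2πiz) dw / (2πiw)` over the unit torus. -/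
def invKasteleyn [NeZero m] [NeZero n] (Bx By : ℝ) (black white : ℤ × ℤ) : ℂ :=
  let x : ℤ := black.1 / (n : ℤ) - white.1 / (n : ℤ)
  let y : ℤ := black.2 / (m : ℤ) - white.2 / (m : ℤ)
  (2 * Real.pi * Complex.I)⁻¹ * ∮ z in C(0, 1), z⁻¹ *
    ((2 * Real.pi * Complex.I)⁻¹ * ∮ w in C(0, 1), w⁻¹ *
      (z ^ (-y) * w ^ x *
        (kasteleyn a b c (Complex.exp Bx * z) (Complex.exp By * w))⁻¹
          (vertexType m n black) (vertexType m n white)))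

/-- The local statistics in the magnetic field `(Bx, By)`: the probability that all the edges of
the finite set `S` are present,
`∏ₖ K(wₖ, bₖ) * det [K⁻¹(bₖ, wₗ)]`. -/
def localStat [NeZero m] [NeZero n] (Bx By : ℝ) (S : Finset Edge) : ℂ :=
  (∏ e ∈ S, (edgeWeight a b c Bx By e : ℂ)) *
    (Matrix.of fun e f : S => invKasteleyn a b c Bx By e.1.black f.1.white).det

/-- `μ` is the Gibbs measure on dimer configurations of the honeycomb lattice, with the given
periodic weights, in the magnetic field `(Bx, By)`: the probability measure (unique, since the
cylinder events generate) whose local statistics are `localStat`. -/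
structure IsGibbsMeasure [NeZero m] [NeZero n] (Bx By : ℝ) (μ : Measure DimerConfig) : Prop where
  isProbabilityMeasure : IsProbabilityMeasure μ
  local_statistics : ∀ S : Finset Edge,
    ((μ.real {C : DimerConfig | ∀ e ∈ S, e ∈ C.1} : ℝ) : ℂ) = localStat a b c Bx By S

/-- The value of `Bx` at which the columns of type `j` switch from `a`-edges to `c`-edges. -/
def threshold [NeZero m] (j : ZMod n) : ℝ := ∑ i : ZMod m, Real.log (a i j / c i j)

/-- With probability tending to `1` as `By → +∞`, the columns of type `j` are filled with edges of
the kind `κ`. First clause: for the local statistics, in every finite window. Second clause: the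
same under the Gibbs measures. Third clause: under the Gibbs measures, for the whole infinite
columns, when `Bx` is not the abscissa of a tentacle of the amoeba. -/
def ColumnsFilled [NeZero m] [NeZero n] (Bx : ℝ) (j : ZMod n) (κ : EdgeType) : Prop :=
  (∀ W : Finset Edge, (∀ e ∈ W, e.kind = κ ∧ (e.white.1 : ZMod n) = j) →
    Tendsto (fun By : ℝ => localStat a b c Bx By W) atTop (𝓝 1)) ∧
  ∀ μ : ℝ → Measure DimerConfig, (∀ᶠ By in atTop, IsGibbsMeasure a b c Bx By (μ By)) →
    (∀ W : Finset (ℤ × ℤ), (∀ v ∈ W, (v.1 : ZMod n) = j) →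
      Tendsto (fun By : ℝ => μ By {C : DimerConfig | ∀ v ∈ W, (⟨v, κ⟩ : Edge) ∈ C.1})
        atTop (𝓝 1)) ∧
    ((∀ j' : ZMod n, Bx ≠ threshold a c j') →
      Tendsto (fun By : ℝ => μ By
        {C : DimerConfig | ∀ v : ℤ × ℤ, (v.1 : ZMod n) = j → (⟨v, κ⟩ : Edge) ∈ C.1})
        atTop (𝓝 1))

end Weights

end HoneycombDimer

end

/-!
In the variable `s = w⁻¹` the Kasteleyn matrix is a pencil `K₀(z) + s K₁`, and suppressing the
`b`-edges between the fundamental domains means shrinking the circle `|s| = t`, `t = exp (-By)`. At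
`s = 0` the columns are coupled in one direction only. Hence the determinant factors over the
columns (`det_pencil_zero`), and the block of the inverse on a column of type `j` is the inverse of
that column alone (`torusAdj_div_torusDet_zero`). A column is singular on the circle `|z| = exp Bx`
only at its threshold, where its `columnRatio` is `1`.

For fixed `z` at which no column is singular, the average over `w` converges to its value at `s = 0`
if the lattice displacement `x` is zero and to `0` otherwise; so `invKasteleyn` should converge to
the inverse `columnKernel` of a single infinite column. This passes through the integral over `z` by
dominated convergence. A bound is not obvious near the point `z₀` of the circle at which other
columns may be singular, because there a zero of the determinant in `s` crosses the circle
`|s| = t`. It holds for the following reason (`exists_bound_circleAverage_of_simple_zero`). The zero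
at `s = 0` is simple: the linear coefficient `firstCoeff` is a sum of products of entries of the
inverses of the columns, rescaled so as to make sense for singular columns too, and at `z₀` all
these products have the same sign (`firstCoeff_ne_zero`). So near `z₀` there is at most one small
zero `s'`, and the integrand is `κ / (s - s')` plus a bounded function, where `κ = O(s')` because
the inverse of column `j` stays bounded at `s = 0`. The average of a power of `w` against
`s' / (s - s')` is explicit and bounded by `1`.

The kernel of a single column satisfies a two-term recursion in the height and is bounded, so it
vanishes on the side of the diagonal on which the recursion would make it grow; which side this is
depends on the sign of `Bx - threshold`. Hence the limiting determinant of a local statistic is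
triangular, and its diagonal cancels the edge weights. Away from all the thresholds the determinant
has no zeros in `|s| ≤ t` for small `t`, the mean value property gives equality with the column
kernel instead of a limit, every edge in question has probability exactly `1`, and a countable
intersection gives the statement for infinite columns.
-/

namespace HoneycombDimer

/-! ### Determinants of cyclic bidiagonal matrices and of the Kasteleyn pencil -/

/-- The cyclic matrix with diagonal `α` and with `β i` in the row `i` and the column `i - 1`. -/
def cyclicBidiag {R : Type*} [CommRing R] {m : ℕ} (α β : ZMod m → R) :
    Matrix (ZMod m) (ZMod m) R :=
  Matrix.of fun i k => (if k = i then α i else 0) + (if k = i - 1 then β i else 0)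

lemma sign_addRight_one_zmod (m : ℕ) [NeZero m] :
    Equiv.Perm.sign (Equiv.addRight (1 : ZMod m)) = (-1) ^ (m - 1) := by
  obtain ⟨k, rfl⟩ := Nat.exists_eq_succ_of_ne_zero (NeZero.ne m)
  rw [← sign_finRotate (k + 1)]
  congr 1
  refine Equiv.ext fun i => ?_
  exact (finRotate_apply (n := k + 1) i).symm

/-- A permutation of `ZMod m` moving every element by `0` or `1` is the identity or the shift. -/
lemma perm_zmod_eq_one_or_addRight {m : ℕ} [NeZero m] (hm : m ≠ 1) (σ : Equiv.Perm (ZMod m))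
    (h : ∀ i, σ i = i ∨ σ i = i + 1) : σ = 1 ∨ σ = Equiv.addRight 1 := by
  have h10 : (1 : ZMod m) ≠ 0 := by
    have : Fact (1 < m) := ⟨by have := NeZero.ne m; omega⟩
    exact one_ne_zero
  by_cases hf : ∃ i₀, σ i₀ = i₀
  · obtain ⟨i₀, h₀⟩ := hf
    left
    have key : ∀ k : ℕ, σ (i₀ - k) = i₀ - k := by
      intro k
      induction k with
      | zero => simpa using h₀
      | succ k ih =>
        rcases h (i₀ - (k + 1 : ℕ)) with h' | h'
        · exact h'
        · exfalso
          have e : i₀ - ((k + 1 : ℕ) : ZMod m) + 1 = i₀ - k := by push_cast; ring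
          rw [e, ← ih] at h'
          have := σ.injective h'
          apply h10
          rw [← e] at this
          simpa using this.symm
    ext i
    have := key (i₀ - i).val
    simpa using this
  · right
    push Not at hf
    ext i
    simpa using (h i).resolve_left (hf i)

/-- Only the identity and the shift contribute to the determinant. -/
lemma det_cyclicBidiag {R : Type*} [CommRing R] {m : ℕ} [NeZero m] (α β : ZMod m → R) :
    (cyclicBidiag α β).det = ∏ i, α i + (-1) ^ (m - 1) * ∏ i, β i := by
  -- for `m = 1` the identity and the shift coincide
  by_cases hm : m = 1
  · subst hm
    have : Unique (ZMod 1) := inferInstanceAs (Unique (Fin 1))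
    rw [Matrix.det_unique, Fintype.prod_unique, Fintype.prod_unique]
    have h1 : ∀ x y : ZMod 1, (x = y) = True := fun _ _ => eq_true (Subsingleton.elim _ _)
    simp only [cyclicBidiag, Matrix.of_apply, h1]
    simp
  have h10 : (1 : ZMod m) ≠ 0 := by
    have : Fact (1 < m) := ⟨by have := NeZero.ne m; omega⟩
    exact one_ne_zero
  rw [Matrix.det_apply, Finset.sum_eq_add (1 : Equiv.Perm (ZMod m)) (Equiv.addRight 1)]
  · rw [sign_addRight_one_zmod]
    simp only [cyclicBidiag, Matrix.of_apply, Equiv.Perm.sign_one, Equiv.Perm.one_apply, if_true,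
      Equiv.coe_addRight, add_sub_cancel_right, one_smul]
    have e1 : ∀ i : ZMod m, (i = i - 1) = False := by
      intro i; simpa [eq_sub_iff_add_eq] using h10
    have e2 : ∀ i : ZMod m, (i = i + 1) = False := by
      intro i; simpa using h10
    simp only [e1, e2, if_false, add_zero, zero_add]
    rw [← Equiv.prod_comp (Equiv.addRight (1 : ZMod m)) β]
    simp [Units.smul_def]
  · intro h
    have := congrArg (fun σ : Equiv.Perm (ZMod m) => σ 0) h
    simp at this
    exact h10 this.symm
  · intro σ _ hσ
    have : ¬ ∀ i, σ i = i ∨ σ i = i + 1 := fun h =>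
      (perm_zmod_eq_one_or_addRight hm σ h).elim hσ.1 hσ.2
    push Not at this
    obtain ⟨i, hi1, hi2⟩ := this
    rw [Finset.prod_eq_zero (Finset.mem_univ i), smul_zero]
    have e1 : i ≠ σ i := fun h => hi1 h.symm
    have e2 : i ≠ σ i - 1 := fun h => hi2 (eq_add_of_sub_eq h.symm)
    simp [cyclicBidiag, e1, e2]
  · simp
  · simp

section Pencil

variable {m n : ℕ} (a b c : ZMod m → ZMod n → ℝ)

/-- The Kasteleyn matrix as a function of `z` and of `s = w⁻¹`, in which it is polynomial. -/
noncomputable def pencil (z s : ℂ) : Matrix (ZMod m × ZMod n) (ZMod m × ZMod n) ℂ :=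
  Matrix.of fun p q =>
    (if q = p then (a p.1 p.2 : ℂ) else 0) +
    (if q = (p.1, p.2 - 1) then (b p.1 p.2 : ℂ) * (if p.2 = 0 then s else 1) else 0) +
    (if q = (p.1 - 1, p.2) then (c p.1 p.2 : ℂ) * (if p.1 = 0 then z else 1) else 0)

lemma kasteleyn_eq_pencil (z w : ℂ) : kasteleyn a b c z w = pencil a b c z w⁻¹ := rfl

/-- The weights of the `c`-edges of column `j`, with the multiplier `z` on the edge which leaves
the fundamental domain. -/
noncomputable def cMult (j : ZMod n) (z : ℂ) (i : ZMod m) : ℂ :=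
  (c i j : ℂ) * (if i = 0 then z else 1)

/-- The Kasteleyn matrix of column `j` alone. -/
noncomputable def columnMatrix (j : ZMod n) (z : ℂ) : Matrix (ZMod m) (ZMod m) ℂ :=
  cyclicBidiag (fun i => (a i j : ℂ)) (cMult c j z)

lemma pencil_mulVec [NeZero m] [NeZero n] (z s : ℂ) (v : ZMod m × ZMod n → ℂ)
    (p : ZMod m × ZMod n) :
    (pencil a b c z s).mulVec v p = (a p.1 p.2 : ℂ) * v p +
      (b p.1 p.2 : ℂ) * (if p.2 = 0 then s else 1) * v (p.1, p.2 - 1) +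
      cMult c p.2 z p.1 * v (p.1 - 1, p.2) := by
  simp only [Matrix.mulVec, dotProduct, pencil, Matrix.of_apply, add_mul, Finset.sum_add_distrib,
    ite_mul, zero_mul, Finset.sum_ite_eq', Finset.mem_univ, if_true, cMult]

lemma cyclicBidiag_mulVec [NeZero m] (α β v : ZMod m → ℂ) (i : ZMod m) :
    (cyclicBidiag α β).mulVec v i = α i * v i + β i * v (i - 1) := by
  simp only [Matrix.mulVec, dotProduct, cyclicBidiag, Matrix.of_apply, add_mul,
    Finset.sum_add_distrib, ite_mul, zero_mul, Finset.sum_ite_eq', Finset.mem_univ, if_true]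

/-- The ratio of the two terms of the determinant of column `j`; the column is singular exactly
where this is `1`. -/
noncomputable def columnRatio [NeZero m] (j : ZMod n) (z : ℂ) : ℂ :=
  (-1) ^ m * z * ∏ i : ZMod m, ((c i j : ℂ) / (a i j : ℂ))

variable {a}

lemma det_columnMatrix [NeZero m] (ha : ∀ i j, 0 < a i j) (j : ZMod n) (z : ℂ) :
    (columnMatrix a c j z).det = (∏ i, (a i j : ℂ)) * (1 - columnRatio a c j z) := by
  have ha' : ∏ i, (a i j : ℂ) ≠ 0 :=
    Finset.prod_ne_zero_iff.2 fun i _ => by exact_mod_cast (ha i j).ne'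
  have hz : ∏ i, cMult c j z i = z * ∏ i, (c i j : ℂ) := by
    simp only [cMult, Finset.prod_mul_distrib, Finset.prod_ite_eq', Finset.mem_univ, if_true]
    rw [mul_comm]
  obtain ⟨k, rfl⟩ := Nat.exists_eq_succ_of_ne_zero (NeZero.ne m)
  rw [columnMatrix, det_cyclicBidiag, hz, columnRatio, Finset.prod_div_distrib]
  field_simp
  simp only [Nat.succ_eq_add_one, Nat.add_sub_cancel, pow_succ]
  ring

lemma val_sub_one_add_one [NeZero n] {j : ZMod n} (hj : j ≠ 0) : (j - 1).val + 1 = j.val := by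
  obtain ⟨k, rfl⟩ := Nat.exists_eq_succ_of_ne_zero (NeZero.ne n)
  have h1 : j.val ≠ 0 := by rwa [Ne, ZMod.val_eq_zero]
  have h2 := ZMod.val_lt j
  have : j - 1 = ((j.val - 1 : ℕ) : ZMod (k + 1)) := by
    rw [Nat.cast_sub (by omega)]; simp
  rw [this, ZMod.val_natCast, Nat.mod_eq_of_lt (by omega)]
  omega

lemma pencil_zero_apply_same [NeZero n] (z : ℂ) (j : ZMod n) (i l : ZMod m) :
    pencil a b c z 0 (i, j) (l, j) = columnMatrix a c j z i l := by
  simp only [pencil, Matrix.of_apply, columnMatrix, cyclicBidiag, cMult, Prod.mk.injEq, and_true]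
  by_cases h0 : j = 0
  · simp [h0]
  · have : ¬ j = j - 1 := fun h => by
      have h3 := val_sub_one_add_one h0
      rw [← h] at h3
      omega
    simp [this]

/-- Without the edges between the fundamental domains, the columns are triangularly coupled. -/
lemma det_pencil_zero [NeZero m] [NeZero n] (z : ℂ) :
    (pencil a b c z 0).det = ∏ j, (columnMatrix a c j z).det := by
  obtain ⟨k, rfl⟩ := Nat.exists_eq_succ_of_ne_zero (NeZero.ne n)
  let f : ZMod m × ZMod (k + 1) → Fin (k + 1) := fun p => p.2
  have hf : (pencil a b c z 0).transpose.BlockTriangular f := by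
    intro q p hpq
    have hlt : p.2.val < q.2.val := hpq
    have h1 : q.2 ≠ p.2 := fun h => by rw [h] at hlt; exact lt_irrefl _ hlt
    simp only [Matrix.transpose_apply, pencil, Matrix.of_apply]
    have e1 : q ≠ p := fun h => h1 (by rw [h])
    have e2 : q ≠ (p.1 - 1, p.2) := fun h => h1 (by rw [h])
    rw [if_neg e1, if_neg e2]
    by_cases h0 : p.2 = 0
    · simp [h0]
    · have e3 : q ≠ (p.1, p.2 - 1) := fun h => by
        have h2 := congrArg Prod.snd h
        have h3 := val_sub_one_add_one h0
        simp only at h2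
        rw [← h2] at h3
        omega
      simp [e3]
  rw [← Matrix.det_transpose, hf.det_fintype]
  refine Finset.prod_congr rfl fun j _ => ?_
  let e : ZMod m ≃ {p : ZMod m × ZMod (k + 1) // f p = j} :=
    { toFun := fun i => ⟨(i, j), rfl⟩
      invFun := fun p => p.1.1
      left_inv := fun _ => rfl
      right_inv := by
        rintro ⟨⟨i, j'⟩, h⟩
        have : j' = j := h
        subst this; rfl }
  rw [← Matrix.det_submatrix_equiv_self e, ← Matrix.det_transpose]
  congr 1
  ext i l
  exact pencil_zero_apply_same b c (a := a) z (j : ZMod (k + 1)) i l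

end Pencil

/-! ### The inverse of a column and the first-order coefficient of the determinant -/

section Column

variable {m n : ℕ} (a b c : ZMod m → ZMod n → ℝ)

lemma prod_zmod_eq_prod_range {R : Type*} [CommMonoid R] {m : ℕ} [NeZero m] (f : ZMod m → R) :
    ∏ i, f i = ∏ k ∈ Finset.range m, f (k : ZMod m) := by
  obtain ⟨k, rfl⟩ := Nat.exists_eq_succ_of_ne_zero (NeZero.ne m)
  rw [← Fin.prod_univ_eq_prod_range (fun k' : ℕ => f (k' : ZMod (k + 1)))]
  refine Finset.prod_congr rfl fun (i : ZMod (k + 1)) _ => ?_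
  exact congrArg f (ZMod.natCast_zmod_val i).symm

lemma natCast_val_sub_one_add_one {n : ℕ} [NeZero n] {j : ZMod n} :
    (((j - 1).val + 1 : ℕ) : ZMod n) = j := by
  push_cast
  simp

lemma val_neg_one_eq (n : ℕ) [NeZero n] : (-1 : ZMod n).val = n - 1 := by
  obtain ⟨k, rfl⟩ := Nat.exists_eq_succ_of_ne_zero (NeZero.ne n)
  exact ZMod.val_neg_one k

/-- A solution of `a h i + c h (i - 1) = 0` inside the fundamental domain, normalized at row `0`. -/
noncomputable def potential (j : ZMod n) (i : ZMod m) : ℂ :=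
  ∏ k ∈ Finset.range i.val, (-((c (k + 1 : ℕ) j : ℂ) / (a (k + 1 : ℕ) j : ℂ)))

/-- The inverse of the matrix of column `j`, multiplied by `1 - columnRatio`: the matrix of a rank
one perturbation of a triangular matrix, which makes sense for singular columns too. -/
noncomputable def columnGreen [NeZero m] (j : ZMod n) (z : ℂ) (i l : ZMod m) : ℂ :=
  potential a c j i / ((a l j : ℂ) * potential a c j l) *
    (if l.val ≤ i.val then 1 else columnRatio a c j z)

variable {a c}

lemma potential_ne_zero (ha : ∀ i j, 0 < a i j) (hc : ∀ i j, 0 < c i j) (j : ZMod n) (i : ZMod m) :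
    potential a c j i ≠ 0 :=
  Finset.prod_ne_zero_iff.2 fun k _ => neg_ne_zero.2 <| div_ne_zero
    (by exact_mod_cast (hc _ j).ne') (by exact_mod_cast (ha _ j).ne')

/-- `columnGreen` is `1 - columnRatio` times a right inverse of the matrix of column `j`. -/
lemma columnGreen_eq [NeZero m] (ha : ∀ i j, 0 < a i j) (hc : ∀ i j, 0 < c i j) (j : ZMod n) (z : ℂ)
    (i l : ZMod m) :
    (a i j : ℂ) * columnGreen a c j z i l + cMult c j z i * columnGreen a c j z (i - 1) l =
      if i = l then 1 - columnRatio a c j z else 0 := by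
  have hl := potential_ne_zero ha hc j l
  have hi := potential_ne_zero ha hc j i
  have hal : (a l j : ℂ) ≠ 0 := by exact_mod_cast (ha l j).ne'
  have hai : (a i j : ℂ) ≠ 0 := by exact_mod_cast (ha i j).ne'
  simp only [columnGreen]
  by_cases h0 : i = 0
  · subst h0
    have hv := val_neg_one_eq m
    have hm := NeZero.pos m
    -- the edge leaving the fundamental domain closes the cycle with the factor `columnRatio`
    have key : cMult c j z 0 * potential a c j (0 - 1) = -(a 0 j : ℂ) * columnRatio a c j z := by
      obtain ⟨k, rfl⟩ := Nat.exists_eq_succ_of_ne_zero (NeZero.ne m)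
      rw [zero_sub, potential, hv, columnRatio, prod_zmod_eq_prod_range, Finset.prod_range_succ']
      simp only [cMult, if_true, Finset.prod_neg, Nat.cast_zero,
        Finset.card_range]
      have e : k.succ - 1 = k := rfl
      rw [e, pow_succ]
      field_simp
    have hp0 : potential a c j 0 = 1 := by simp [potential]
    have hle : l.val ≤ (0 - 1 : ZMod m).val := by
      rw [zero_sub, hv]; have := ZMod.val_lt l; omega
    rw [if_pos hle, mul_one, mul_div_assoc', key, hp0]
    by_cases hl0 : l = 0
    · subst hl0
      simp only [le_refl, if_true, hp0]
      field_simp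
      ring
    · have : ¬ l.val ≤ (0 : ZMod m).val := by
        rw [ZMod.val_zero]
        have : l.val ≠ 0 := by rwa [Ne, ZMod.val_eq_zero]
        omega
      rw [if_neg this, if_neg (Ne.symm hl0)]
      field_simp
      ring
  · have hv := val_sub_one_add_one h0
    have key : cMult c j z i * potential a c j (i - 1) = -((a i j : ℂ) * potential a c j i) := by
      rw [potential.eq_1 a c j i, ← hv, Finset.prod_range_succ, ← potential, natCast_val_sub_one_add_one]
      simp only [cMult, if_neg h0]
      field_simp
    rw [← mul_assoc, ← mul_assoc, mul_div_assoc', mul_div_assoc', key]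
    by_cases hil : i = l
    · subst hil
      have : ¬ i.val ≤ (i - 1).val := by omega
      rw [if_pos le_rfl, if_neg this, if_pos rfl]
      field_simp
      ring
    · have hne : i.val ≠ l.val := fun h => hil (ZMod.val_injective m h)
      have : (l.val ≤ i.val) ↔ (l.val ≤ (i - 1).val) := by omega
      simp only [this, if_neg hil]
      ring

/-- `x` is a positive number multiplied by the sign `(-1) ^ k`. -/
def HasSign (k : ℕ) (x : ℂ) : Prop := ∃ p : ℝ, 0 < p ∧ x = (-1) ^ k * (p : ℂ)

lemma HasSign.mul {k l : ℕ} {x y : ℂ} (hx : HasSign k x) (hy : HasSign l y) :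
    HasSign (k + l) (x * y) := by
  obtain ⟨p, hp, rfl⟩ := hx
  obtain ⟨q, hq, rfl⟩ := hy
  exact ⟨p * q, mul_pos hp hq, by push_cast; ring⟩

lemma HasSign.inv {k : ℕ} {x : ℂ} (hx : HasSign k x) : HasSign k x⁻¹ := by
  obtain ⟨p, hp, rfl⟩ := hx
  refine ⟨p⁻¹, inv_pos.2 hp, ?_⟩
  rw [mul_inv, ← inv_pow]
  norm_num

lemma HasSign.neg {k : ℕ} {x : ℂ} (hx : HasSign k x) : HasSign (k + 1) (-x) := by
  obtain ⟨p, hp, rfl⟩ := hx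
  exact ⟨p, hp, by ring⟩

lemma HasSign.congr {k l : ℕ} {x : ℂ} (hx : HasSign k x) (h : k % 2 = l % 2) : HasSign l x := by
  obtain ⟨p, hp, rfl⟩ := hx
  exact ⟨p, hp, by rw [neg_one_pow_eq_pow_mod_two, h, ← neg_one_pow_eq_pow_mod_two]⟩

lemma HasSign.sum {ι : Type*} [Fintype ι] [Nonempty ι] {k : ℕ} {x : ι → ℂ}
    (hx : ∀ i, HasSign k (x i)) : HasSign k (∑ i, x i) := by
  choose p hp hxp using hx
  refine ⟨∑ i, p i, Finset.sum_pos (fun i _ => hp i) Finset.univ_nonempty, ?_⟩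
  push_cast
  rw [Finset.mul_sum]
  exact Finset.sum_congr rfl fun i _ => hxp i

lemma HasSign.of_pos {p : ℝ} (hp : 0 < p) : HasSign 0 (p : ℂ) := ⟨p, hp, by simp⟩

lemma HasSign.ne_zero {k : ℕ} {x : ℂ} (hx : HasSign k x) : x ≠ 0 := by
  obtain ⟨p, hp, rfl⟩ := hx
  have : (p : ℂ) ≠ 0 := by exact_mod_cast hp.ne'
  exact mul_ne_zero (pow_ne_zero _ (by norm_num)) this

lemma hasSign_potential (ha : ∀ i j, 0 < a i j) (hc : ∀ i j, 0 < c i j) (j : ZMod n) (i : ZMod m) :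
    HasSign i.val (potential a c j i) := by
  rw [potential]
  induction i.val with
  | zero => exact ⟨1, one_pos, by simp⟩
  | succ k ih =>
    rw [Finset.prod_range_succ]
    refine ih.mul (l := 1) (HasSign.neg (k := 0) ?_)
    have := HasSign.of_pos (div_pos (hc (k + 1 : ℕ) j) (ha (k + 1 : ℕ) j))
    push_cast at this ⊢
    exact this

lemma hasSign_columnGreen [NeZero m] (ha : ∀ i j, 0 < a i j) (hc : ∀ i j, 0 < c i j) {j : ZMod n}
    {z : ℂ} (hz : HasSign 0 (columnRatio a c j z)) (i l : ZMod m) :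
    HasSign (i.val + l.val) (columnGreen a c j z i l) := by
  have h1 : HasSign 0 (if l.val ≤ i.val then 1 else columnRatio a c j z) := by
    split_ifs
    · exact ⟨1, one_pos, by simp⟩
    · exact hz
  rw [columnGreen, div_eq_mul_inv]
  refine (((hasSign_potential ha hc j i).mul
    ((HasSign.of_pos (ha l j)).mul (hasSign_potential ha hc j l)).inv).mul h1).congr ?_
  omega

variable (a c)

/-- Up to the product of the `1 - columnRatio`, the column `k` of the solution of
`pencil z 0 * u = e`, where `e` is the basis vector of row `i₀` in column `0`. -/
noncomputable def propagated [NeZero m] (z : ℂ) (i₀ : ZMod m) : ℕ → ZMod m → ℂ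
  | 0 => fun i => columnGreen a c 0 z i i₀
  | k + 1 => fun i => -∑ l, columnGreen a c ((k + 1 : ℕ) : ZMod n) z i l *
      ((b l ((k + 1 : ℕ) : ZMod n) : ℂ) * propagated z i₀ k l)

variable {a b c}

/-- The signs from the intermediate rows `l` occur twice and cancel, so that all the terms of each sum
have the same sign. -/
lemma hasSign_propagated [NeZero m] (ha : ∀ i j, 0 < a i j) (hb : ∀ i j, 0 < b i j)
    (hc : ∀ i j, 0 < c i j) {z : ℂ} (hz : ∀ j, HasSign 0 (columnRatio a c j z)) (i₀ : ZMod m)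
    (k : ℕ) (i : ZMod m) : HasSign (k + i.val + i₀.val) (propagated a b c z i₀ k i) := by
  induction k generalizing i with
  | zero => exact (hasSign_columnGreen ha hc (hz 0) i i₀).congr (by omega)
  | succ k ih =>
    rw [propagated]
    refine (HasSign.neg (k := k + i.val + i₀.val) ?_).congr (by omega)
    refine HasSign.sum fun l => ?_
    refine ((hasSign_columnGreen ha hc (hz _) i l).mul
      ((HasSign.of_pos (hb l _)).mul (ih l))).congr (by omega)

lemma continuous_columnRatio [NeZero m] (j : ZMod n) : Continuous (columnRatio a c j) := by
  unfold columnRatio; fun_prop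

lemma continuous_columnGreen [NeZero m] (j : ZMod n) (i l : ZMod m) :
    Continuous fun z => columnGreen a c j z i l := by
  have := continuous_columnRatio (a := a) (c := c) j
  simp only [columnGreen]
  split_ifs <;> fun_prop

lemma continuous_propagated [NeZero m] (i₀ : ZMod m) (k : ℕ) (i : ZMod m) :
    Continuous fun z => propagated a b c z i₀ k i := by
  induction k generalizing i with
  | zero => exact continuous_columnGreen 0 i i₀
  | succ k ih =>
    simp only [propagated]
    exact (continuous_finsetSum _ fun l _ =>
      (continuous_columnGreen _ i l).mul (continuous_const.mul (ih l))).neg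

lemma sum_mul_columnGreen [NeZero m] (ha : ∀ i j, 0 < a i j) (hc : ∀ i j, 0 < c i j) (j : ZMod n)
    (z : ℂ) (f : ZMod m → ℂ) (i : ZMod m) :
    (a i j : ℂ) * (∑ l, columnGreen a c j z i l * f l) +
      cMult c j z i * (∑ l, columnGreen a c j z (i - 1) l * f l) =
      (1 - columnRatio a c j z) * f i := by
  have : ∀ l, (a i j : ℂ) * (columnGreen a c j z i l * f l) +
      cMult c j z i * (columnGreen a c j z (i - 1) l * f l) =
      if i = l then (1 - columnRatio a c j z) * f l else 0 := by
    intro l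
    rw [← mul_assoc, ← mul_assoc, ← add_mul, columnGreen_eq ha hc]
    split_ifs <;> simp
  rw [Finset.mul_sum, Finset.mul_sum, ← Finset.sum_add_distrib, Finset.sum_congr rfl
    fun l _ => this l]
  simp

/-- The system `pencil z 0 * u = e` is solved one column after the other, starting at column `0`. -/
lemma pencil_mulVec_propagated [NeZero m] [NeZero n] (ha : ∀ i j, 0 < a i j)
    (hc : ∀ i j, 0 < c i j) {z : ℂ} (hz : ∀ j, 1 - columnRatio a c j z ≠ 0) (i₀ : ZMod m) :
    (pencil a b c z 0).mulVec (fun p => propagated a b c z i₀ p.2.val p.1 /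
      ∏ k ∈ Finset.range (p.2.val + 1), (1 - columnRatio a c (k : ZMod n) z)) =
      Pi.single (i₀, 0) 1 := by
  ext ⟨i, j⟩
  rw [pencil_mulVec]
  by_cases h0 : j = 0
  · subst h0
    have := columnGreen_eq ha hc 0 z i i₀
    simp only [if_true, mul_zero, zero_mul, ZMod.val_zero, zero_add, propagated,
      Finset.prod_range_one, Nat.cast_zero, ← mul_div_assoc, Pi.single_apply,
      Prod.mk.injEq, and_true]
    have h1 := hz 0
    split_ifs
    · rw [if_pos ‹_›] at this
      rw [zero_div, add_zero, ← add_div, this, div_self h1]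
    · rw [if_neg ‹_›] at this
      rw [zero_div, add_zero, ← add_div, this, zero_div]
  · have hv := val_sub_one_add_one h0
    have hne : ((i, j) : ZMod m × ZMod n) ≠ (i₀, 0) := fun h => h0 (congrArg Prod.snd h)
    simp only [if_neg h0, mul_one, Pi.single_apply, if_neg hne]
    simp only [← hv, propagated, natCast_val_sub_one_add_one]
    have h1 := hz j
    have h2 : ∏ k ∈ Finset.range ((j - 1).val + 1), (1 - columnRatio a c (k : ZMod n) z) ≠ 0 :=
      Finset.prod_ne_zero_iff.2 fun k _ => hz _
    rw [Finset.prod_range_succ _ ((j - 1).val + 1), natCast_val_sub_one_add_one]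
    have h3 := sum_mul_columnGreen ha hc j z
      (fun l => (b l j : ℂ) * propagated a b c z i₀ (j - 1).val l) i
    generalize ∑ l, columnGreen a c j z i l * ((b l j : ℂ) * propagated a b c z i₀ (j - 1).val l)
      = S at h3 ⊢
    generalize ∑ l, columnGreen a c j z (i - 1) l *
      ((b l j : ℂ) * propagated a b c z i₀ (j - 1).val l) = S' at h3 ⊢
    field_simp
    linear_combination -h3

lemma det_pencil_zero_eq_prod [NeZero m] [NeZero n] (ha : ∀ i j, 0 < a i j) (z : ℂ) :
    (pencil a b c z 0).det =
      (∏ j, ∏ i, (a i j : ℂ)) * ∏ j, (1 - columnRatio a c j z) := by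
  rw [det_pencil_zero, ← Finset.prod_mul_distrib]
  exact Finset.prod_congr rfl fun j _ => det_columnMatrix c ha j z

lemma det_pencil_zero_ne_zero_iff [NeZero m] [NeZero n] (ha : ∀ i j, 0 < a i j) (z : ℂ) :
    (pencil a b c z 0).det ≠ 0 ↔ ∀ j, 1 - columnRatio a c j z ≠ 0 := by
  have : ∏ j, ∏ i, (a i j : ℂ) ≠ 0 := Finset.prod_ne_zero_iff.2 fun j _ =>
    Finset.prod_ne_zero_iff.2 fun i _ => by exact_mod_cast (ha i j).ne'
  rw [det_pencil_zero_eq_prod ha, mul_ne_zero_iff, Finset.prod_ne_zero_iff (s := Finset.univ)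
    (f := fun j => 1 - columnRatio a c j z)]
  simp only [this, ne_eq, not_false_eq_true, true_and, Finset.mem_univ, true_implies]

variable (a b c)

/-- The coefficient of `s` in `det (pencil z s)`. -/
noncomputable def firstCoeff [NeZero m] [NeZero n] (z : ℂ) : ℂ :=
  (∏ j, ∏ i, (a i j : ℂ)) * ∑ i, (b i 0 : ℂ) * propagated a b c z i (n - 1) i

variable {a b c}

lemma continuous_firstCoeff [NeZero m] [NeZero n] : Continuous (firstCoeff a b c) :=
  continuous_const.mul <| continuous_finsetSum _ fun i _ =>
    continuous_const.mul (continuous_propagated i (n - 1) i)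

/-- Where all the column ratios are positive, no cancellation occurs in `firstCoeff`. -/
lemma firstCoeff_ne_zero [NeZero m] [NeZero n] (ha : ∀ i j, 0 < a i j) (hb : ∀ i j, 0 < b i j)
    (hc : ∀ i j, 0 < c i j) {z : ℂ} (hz : ∀ j, HasSign 0 (columnRatio a c j z)) :
    firstCoeff a b c z ≠ 0 := by
  refine mul_ne_zero (Finset.prod_ne_zero_iff.2 fun j _ =>
    Finset.prod_ne_zero_iff.2 fun i _ => by exact_mod_cast (ha i j).ne') ?_
  refine HasSign.ne_zero (k := n - 1) (HasSign.sum fun i => ?_)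
  exact ((HasSign.of_pos (hb i 0)).mul (hasSign_propagated ha hb hc hz i (n - 1) i)).congr
    (by omega)

lemma hasDerivAt_det_one_add_smul {ι : Type*} [Fintype ι] [DecidableEq ι] (M : Matrix ι ι ℂ) :
    HasDerivAt (fun s : ℂ => (1 + s • M).det) M.trace 0 := by
  set q := (Matrix.det (1 + (Polynomial.X : Polynomial ℂ) • M.map Polynomial.C)).divX.divX
  have h : HasDerivAt (fun s : ℂ => 1 + M.trace * s + q.eval s * s ^ 2)
      (M.trace * 1 + (q.derivative.eval 0 * 0 ^ 2 + q.eval 0 * ((2 : ℕ) * 0 ^ (2 - 1) * 1))) 0 :=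
    (((hasDerivAt_id (0 : ℂ)).const_mul M.trace).const_add 1).add
      ((q.hasDerivAt 0).mul ((hasDerivAt_id (0 : ℂ)).pow 2))
  convert! h using 1
  · ext s
    rw [Matrix.det_one_add_smul s M]
  · simp

/-- Writing `K₀ + s K₁ = K₀ (1 + s K₀⁻¹ K₁)`, the derivative at `s = 0` is `det K₀ * tr (K₀⁻¹ K₁)`. Only
the block of `K₀⁻¹` from column `0` to the last column enters the trace. -/
lemma hasDerivAt_det_pencil [NeZero m] [NeZero n] (ha : ∀ i j, 0 < a i j)
    (hc : ∀ i j, 0 < c i j) {z : ℂ} (hz : ∀ j, 1 - columnRatio a c j z ≠ 0) :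
    HasDerivAt (fun s => (pencil a b c z s).det) (firstCoeff a b c z) 0 := by
  have hdet : (pencil a b c z 0).det ≠ 0 := (det_pencil_zero_ne_zero_iff ha z).2 hz
  have hU : IsUnit (pencil a b c z 0).det := isUnit_iff_ne_zero.2 hdet
  -- the `b`-edges between the fundamental domains
  let K₁ : Matrix (ZMod m × ZMod n) (ZMod m × ZMod n) ℂ :=
    Matrix.of fun p q => if q = (p.1, p.2 - 1) then if p.2 = 0 then (b p.1 p.2 : ℂ) else 0 else 0
  have hK : ∀ s, pencil a b c z s =
      pencil a b c z 0 * (1 + s • ((pencil a b c z 0)⁻¹ * K₁)) := by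
    intro s
    rw [mul_add, mul_one, mul_smul_comm, ← mul_assoc, Matrix.mul_nonsing_inv _ hU, one_mul]
    ext p q
    simp only [pencil, K₁, Matrix.of_apply, Matrix.add_apply, Matrix.smul_apply, smul_eq_mul]
    split_ifs <;> ring
  have hcol : ∀ p (i₀ : ZMod m), (pencil a b c z 0)⁻¹ p (i₀, 0) =
      propagated a b c z i₀ p.2.val p.1 /
      ∏ k ∈ Finset.range (p.2.val + 1), (1 - columnRatio a c (k : ZMod n) z) := by
    intro p i₀
    have := congrArg (fun v => (pencil a b c z 0)⁻¹.mulVec v p)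
      (pencil_mulVec_propagated (b := b) ha hc hz i₀)
    simp only [Matrix.mulVec_mulVec, Matrix.nonsing_inv_mul _ hU, Matrix.one_mulVec,
      Matrix.mulVec_single_one] at this
    exact this.symm
  have htr : ((pencil a b c z 0)⁻¹ * K₁).trace =
      (∑ i, (b i 0 : ℂ) * propagated a b c z i (n - 1) i) / ∏ j, (1 - columnRatio a c j z) := by
    rw [Matrix.trace_mul_comm, Matrix.trace, Fintype.sum_prod_type_right]
    rw [Finset.sum_eq_single (0 : ZMod n)]
    · rw [Finset.sum_div]
      refine Finset.sum_congr rfl fun i _ => ?_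
      simp only [Matrix.diag_apply, Matrix.mul_apply, K₁, Matrix.of_apply, if_true, ite_mul,
        zero_mul, Finset.sum_ite_eq', Finset.mem_univ, hcol, zero_sub]
      rw [val_neg_one_eq, Nat.sub_add_cancel (NeZero.pos n),
        prod_zmod_eq_prod_range (fun j => 1 - columnRatio a c j z), mul_div_assoc]
    · intro j _ hj
      refine Finset.sum_eq_zero fun i _ => ?_
      simp [Matrix.mul_apply, K₁, hj]
    · simp
  have hD := (hasDerivAt_det_one_add_smul ((pencil a b c z 0)⁻¹ * K₁)).const_mul
    (pencil a b c z 0).det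
  rw [htr, det_pencil_zero_eq_prod ha, mul_assoc, mul_div_cancel₀] at hD
  · rw [firstCoeff]
    refine hD.congr_of_eventuallyEq (Eventually.of_forall fun s => ?_)
    simp only
    rw [hK s, Matrix.det_mul, ← det_pencil_zero_eq_prod ha]
  · exact Finset.prod_ne_zero_iff.2 fun j _ => hz j

end Column

/-! ### Functions with a smooth divided difference -/

/-- `f z s` is continuously differentiable, and so is its divided difference in `s`. -/
structure HasSlope (f : ℂ → ℂ → ℂ) : Prop where
  contDiff : ContDiff ℂ 1 fun p : ℂ × ℂ => f p.1 p.2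
  exists_slope : ∃ H : ℂ × ℂ × ℂ → ℂ, ContDiff ℂ 1 H ∧
    ∀ z s s', f z s - f z s' = (s - s') * H (z, s, s')

namespace HasSlope

lemma of_fst {g : ℂ → ℂ} (hg : ContDiff ℂ 1 g) : HasSlope fun z _ => g z :=
  ⟨hg.comp contDiff_fst, 0, contDiff_const, fun _ _ _ => by simp⟩

lemma const (k : ℂ) : HasSlope fun _ _ => k := of_fst contDiff_const

lemma snd : HasSlope fun _ s => s :=
  ⟨contDiff_snd, 1, contDiff_const, fun _ _ _ => by simp⟩

lemma add {f g : ℂ → ℂ → ℂ} (hf : HasSlope f) (hg : HasSlope g) :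
    HasSlope fun z s => f z s + g z s := by
  obtain ⟨hf, F, hF, hF'⟩ := hf
  obtain ⟨hg, G, hG, hG'⟩ := hg
  exact ⟨hf.add hg, fun p => F p + G p, hF.add hG, fun z s s' => by
    linear_combination hF' z s s' + hG' z s s'⟩

lemma mul {f g : ℂ → ℂ → ℂ} (hf : HasSlope f) (hg : HasSlope g) :
    HasSlope fun z s => f z s * g z s := by
  obtain ⟨hf, F, hF, hF'⟩ := hf
  obtain ⟨hg, G, hG, hG'⟩ := hg
  refine ⟨hf.mul hg, fun p => f p.1 p.2.1 * G p + F p * g p.1 p.2.2, ?_, fun z s s' => by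
    linear_combination f z s * hG' z s s' + g z s' * hF' z s s'⟩
  have h1 : ContDiff ℂ 1 fun p : ℂ × ℂ × ℂ => f p.1 p.2.1 :=
    hf.comp (contDiff_fst.prodMk (contDiff_fst.comp contDiff_snd))
  have h2 : ContDiff ℂ 1 fun p : ℂ × ℂ × ℂ => g p.1 p.2.2 :=
    hg.comp (contDiff_fst.prodMk (contDiff_snd.comp contDiff_snd))
  exact (h1.mul hG).add (hF.mul h2)

lemma sum {ι : Type*} (t : Finset ι) {f : ι → ℂ → ℂ → ℂ} (hf : ∀ i, HasSlope (f i)) :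
    HasSlope fun z s => ∑ i ∈ t, f i z s := by
  classical
  induction t using Finset.induction_on with
  | empty => simpa using const 0
  | insert i t hi ih => simpa only [Finset.sum_insert hi] using (hf i).add ih

lemma prod {ι : Type*} (t : Finset ι) {f : ι → ℂ → ℂ → ℂ} (hf : ∀ i, HasSlope (f i)) :
    HasSlope fun z s => ∏ i ∈ t, f i z s := by
  classical
  induction t using Finset.induction_on with
  | empty => simpa using const 1
  | insert i t hi ih => simpa only [Finset.prod_insert hi] using (hf i).mul ih

lemma det {ι : Type*} [Fintype ι] [DecidableEq ι] {M : ℂ → ℂ → Matrix ι ι ℂ}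
    (hM : ∀ i j, HasSlope fun z s => M z s i j) : HasSlope fun z s => (M z s).det := by
  simp only [Matrix.det_apply']
  exact sum _ fun σ => (const _).mul (prod _ fun i => hM _ _)

lemma adjugate {ι : Type*} [Fintype ι] [DecidableEq ι] {M : ℂ → ℂ → Matrix ι ι ℂ}
    (hM : ∀ i j, HasSlope fun z s => M z s i j) (k l : ι) :
    HasSlope fun z s => (M z s).adjugate k l := by
  simp only [Matrix.adjugate_apply]
  refine det fun i j => ?_
  simp only [Matrix.updateRow_apply]
  split_ifs
  · exact const _
  · exact hM i j

lemma continuous {f : ℂ → ℂ → ℂ} (hf : HasSlope f) : Continuous fun p : ℂ × ℂ => f p.1 p.2 :=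
  hf.contDiff.continuous

lemma continuous_right {f : ℂ → ℂ → ℂ} (hf : HasSlope f) (z : ℂ) : Continuous (f z) :=
  hf.continuous.comp (Continuous.prodMk_right z)

lemma differentiable_right {f : ℂ → ℂ → ℂ} (hf : HasSlope f) (z : ℂ) : Differentiable ℂ (f z) :=
  (hf.contDiff.comp ((contDiff_const (c := z)).prodMk contDiff_id)).differentiable one_ne_zero

lemma deriv_eq {f : ℂ → ℂ → ℂ} {H : ℂ × ℂ × ℂ → ℂ} (hH : ContDiff ℂ 1 H)
    (h : ∀ z s s', f z s - f z s' = (s - s') * H (z, s, s')) (z : ℂ) :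
    deriv (f z) 0 = H (z, 0, 0) := by
  apply HasDerivAt.deriv
  rw [hasDerivAt_iff_tendsto_slope]
  have h1 : Tendsto (fun s => H (z, s, 0)) (𝓝[≠] 0) (𝓝 (H (z, 0, 0))) :=
    ((hH.continuous.comp (by fun_prop : Continuous fun s : ℂ => (z, s, (0 : ℂ)))).tendsto 0).mono_left
      nhdsWithin_le_nhds
  refine h1.congr' ?_
  filter_upwards [self_mem_nhdsWithin] with s hs
  have hs' : s ≠ 0 := hs
  rw [slope_def_field, h z s 0, sub_zero, mul_div_cancel_left₀ _ hs']

lemma continuous_deriv {f : ℂ → ℂ → ℂ} (hf : HasSlope f) :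
    Continuous fun z => deriv (f z) 0 := by
  obtain ⟨-, H, hH, h⟩ := hf
  simp only [deriv_eq hH h]
  exact hH.continuous.comp (by fun_prop)

end HasSlope

/-! ### Circle averages near a singular point -/

lemma circleIntegrable_of_bounded {f : ℂ → ℂ} (hf : Measurable f) {C : ℝ}
    (hC : ∀ w, ‖w‖ = 1 → ‖f w‖ ≤ C) : CircleIntegrable f 0 1 := by
  refine IntervalIntegrable.mono_fun' (g := fun _ => C) intervalIntegrable_const ?_ ?_
  · exact (hf.comp (measurable_circleMap 0 1)).aestronglyMeasurable
  · exact ae_of_all _ fun θ => hC _ (by simp)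

lemma norm_circleAverage_le {f : ℂ → ℂ} {C : ℝ} (hC : ∀ w, ‖w‖ = 1 → ‖f w‖ ≤ C) :
    ‖Real.circleAverage f 0 1‖ ≤ C := by
  rw [Real.circleAverage_eq_circleIntegral one_ne_zero]
  have := circleIntegral.norm_two_pi_i_inv_smul_integral_le_of_norm_le_const (c := 0) (R := 1)
    (C := C) (f := fun w : ℂ => (w - 0)⁻¹ • f w) zero_le_one (fun w hw => by
      have h1 : ‖w‖ = 1 := by simpa using hw
      rw [norm_smul, norm_inv, sub_zero, h1, inv_one, one_mul]
      exact hC w h1)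
  simpa using this

lemma circleIntegral_zpow (x : ℤ) :
    (∮ w in C(0, 1), w ^ x) = if x = -1 then 2 * Real.pi * Complex.I else 0 := by
  split_ifs with h
  · subst h
    simpa using circleIntegral.integral_sub_center_inv 0 (one_ne_zero (α := ℝ))
  · simpa using circleIntegral.integral_sub_zpow_of_ne h 0 0 1

/-- The integral of `w ^ x / (w - ζ)` over the unit circle is, up to a factor `± 2 π I`, either `0`
or a power of `ζ` of norm at most `1`; for `ζ` on the circle it is `0` by convention. -/
lemma norm_circleIntegral_zpow_mul_inv_le (x : ℤ) (ζ : ℂ) :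
    ‖∮ w in C(0, 1), w ^ x * (w - ζ)⁻¹‖ ≤ 2 * Real.pi := by
  have hpi : 0 ≤ 2 * Real.pi := by positivity
  have hne0 : ∀ w ∈ Metric.sphere (0 : ℂ) 1, w ≠ 0 := fun w hw h => by simp [h] at hw
  have hz : ∀ x : ℤ, ContinuousOn (fun w : ℂ => w ^ x) (Metric.sphere 0 1) := fun x w hw =>
    (continuousAt_zpow₀ w x (Or.inl (hne0 w hw))).continuousWithinAt
  by_cases h1 : ‖ζ‖ = 1
  · rw [circleIntegral.integral_undef]
    · simpa using hpi
    · intro hi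
      have h2 : CircleIntegrable (fun w => (w - ζ)⁻¹) 0 1 := by
        have := hi.continuousOn_mul (g := fun w : ℂ => w ^ (-x))
          (by rw [abs_one]; exact hz (-x))
        refine (circleIntegrable_congr ?_).1 this
        intro w hw
        have := hne0 w (by simpa using hw)
        simp only [Pi.mul_apply]
        rw [← mul_assoc, ← zpow_add₀ this]
        simp
      rw [circleIntegrable_sub_inv_iff] at h2
      simp [h1] at h2
  have hne : ∀ w ∈ Metric.sphere (0 : ℂ) 1, w - ζ ≠ 0 := fun w hw h => h1 (by
    rw [← sub_eq_zero.1 h]; simpa using hw)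
  have hci : ContinuousOn (fun w : ℂ => (w - ζ)⁻¹) (Metric.sphere 0 1) :=
    (continuousOn_id.sub continuousOn_const).inv₀ hne
  have hint : ∀ x : ℤ, CircleIntegrable (fun w : ℂ => w ^ x * (w - ζ)⁻¹) 0 1 := fun x =>
    ((hz x).mul hci).circleIntegrable zero_le_one
  set J : ℤ → ℂ := fun x => ∮ w in C(0, 1), w ^ x * (w - ζ)⁻¹ with hJ
  have hrec : ∀ x, J (x + 1) = (if x = -1 then 2 * Real.pi * Complex.I else 0) + ζ * J x := by
    intro x
    rw [← circleIntegral_zpow, hJ]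
    simp only
    rw [← circleIntegral.integral_const_mul, ← circleIntegral.integral_add]
    · refine circleIntegral.integral_congr zero_le_one fun w hw => ?_
      have h2 := hne w hw
      rw [zpow_add_one₀ (hne0 w hw)]
      field_simp
      ring
    · exact (hz x).circleIntegrable zero_le_one
    · exact (continuousOn_const.mul ((hz x).mul hci)).circleIntegrable zero_le_one
  change ‖J x‖ ≤ _
  have hnorm : ‖(2 * Real.pi * Complex.I : ℂ)‖ = 2 * Real.pi := by
    simp [abs_of_pos Real.pi_pos]
  by_cases hζ0 : ζ = 0
  · have := circleIntegral.norm_integral_le_of_norm_le_const (c := 0) (R := 1) (C := 1)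
      (f := fun w : ℂ => w ^ x * (w - ζ)⁻¹) zero_le_one (fun w hw => by
        have h1 : ‖w‖ = 1 := by simpa using hw
        simp [hζ0, h1])
    simpa using this
  rcases lt_or_gt_of_ne h1 with hlt | hgt
  · have h0 : J 0 = 2 * Real.pi * Complex.I := by
      simpa [hJ] using circleIntegral.integral_sub_inv_of_mem_ball (c := 0) (R := 1) (w := ζ)
        (by simpa using hlt)
    have hpos : ∀ k : ℕ, J k = 2 * Real.pi * Complex.I * ζ ^ k := by
      intro k
      induction k with
      | zero => simpa using h0
      | succ k ih =>
        push_cast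
        rw [hrec, ih, if_neg (by omega)]
        ring
    have hneg : ∀ k : ℕ, J (-(k + 1 : ℕ)) = 0 := by
      intro k
      induction k with
      | zero =>
        have := hrec (-1)
        rw [if_pos rfl] at this
        norm_num [h0, hζ0] at this
        simpa using this
      | succ k ih =>
        have := hrec (-(k + 1 + 1 : ℕ))
        rw [if_neg (by push_cast; omega), zero_add] at this
        rw [show (-((k + 1 + 1 : ℕ) : ℤ) + 1) = -((k + 1 : ℕ) : ℤ) by push_cast; ring, ih] at this
        exact (mul_eq_zero.1 this.symm).resolve_left hζ0
    rcases le_or_gt 0 x with hx | hx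
    · lift x to ℕ using hx
      rw [hpos, norm_mul, hnorm, norm_pow]
      exact mul_le_of_le_one_right hpi (pow_le_one₀ (norm_nonneg _) hlt.le)
    · obtain ⟨k, rfl⟩ : ∃ k : ℕ, x = -(k + 1 : ℕ) := ⟨(-x - 1).toNat, by omega⟩
      rw [hneg]
      simpa using hpi
  · have h0 : J 0 = 0 := by
      have hd : DifferentiableOn ℂ (fun w : ℂ => (w - ζ)⁻¹) (Metric.closedBall 0 1) := by
        intro w hw
        refine ((differentiableAt_id.sub_const ζ).inv ?_).differentiableWithinAt
        intro h
        have : ‖w‖ ≤ 1 := by simpa using hw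
        rw [sub_eq_zero] at h
        rw [← h] at hgt
        simp only [id] at hgt
        linarith
      have := Complex.circleIntegral_eq_zero_of_differentiable_on_off_countable (c := 0) (R := 1)
        zero_le_one Set.countable_empty hd.continuousOn (fun w hw =>
          (hd w (Metric.ball_subset_closedBall hw.1)).differentiableAt
            (Metric.closedBall_mem_nhds_of_mem hw.1))
      simpa [hJ] using this
    have hpos : ∀ k : ℕ, J k = 0 := by
      intro k
      induction k with
      | zero => simpa using h0
      | succ k ih =>
        push_cast
        rw [hrec, ih, if_neg (by omega)]
        ring
    have hneg : ∀ k : ℕ, J (-(k + 1 : ℕ)) = -(2 * Real.pi * Complex.I) * (ζ⁻¹) ^ (k + 1) := by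
      intro k
      induction k with
      | zero =>
        have := hrec (-1)
        rw [if_pos rfl, show (-1 + 1 : ℤ) = 0 by norm_num, h0] at this
        rw [show (-((0 + 1 : ℕ) : ℤ)) = -1 by norm_num]
        rw [zero_add, pow_one]
        field_simp
        linear_combination -this
      | succ k ih =>
        have := hrec (-(k + 1 + 1 : ℕ))
        rw [if_neg (by push_cast; omega), zero_add] at this
        rw [show (-((k + 1 + 1 : ℕ) : ℤ) + 1) = -((k + 1 : ℕ) : ℤ) by push_cast; ring, ih] at this
        rw [pow_succ _ (k + 1), ← mul_assoc, this]
        field_simp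
    rcases le_or_gt 0 x with hx | hx
    · lift x to ℕ using hx
      rw [hpos]
      simpa using hpi
    · obtain ⟨k, rfl⟩ : ∃ k : ℕ, x = -(k + 1 : ℕ) := ⟨(-x - 1).toNat, by omega⟩
      rw [hneg, norm_mul, norm_neg, hnorm, norm_pow, norm_inv]
      exact mul_le_of_le_one_right hpi (pow_le_one₀ (by positivity) (inv_le_one_of_one_le₀ hgt.le))

/-- Near a point `z₀` where `P z₀` has a simple zero at `s = 0`, the circle averages of `Q / P`
over `|s| = t` remain bounded, although a zero of `P z` may approach or cross the circle. -/
lemma exists_bound_circleAverage_of_simple_zero {P Q : ℂ → ℂ → ℂ} (hP : HasSlope P)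
    (hQ : HasSlope Q) {z₀ : ℂ} (h0 : P z₀ 0 = 0) (h1 : deriv (P z₀) 0 ≠ 0) {A : ℝ} (hA : 0 ≤ A)
    (hα : ∀ᶠ z in 𝓝 z₀, P z 0 ≠ 0 → ‖Q z 0‖ ≤ A * ‖P z 0‖) (x : ℤ) :
    ∃ r > 0, ∃ C, ∀ᶠ z in 𝓝 z₀, P z 0 ≠ 0 → ∀ t : ℝ, 0 < t → t ≤ r →
      ‖Real.circleAverage (fun w => w ^ x * (Q z (t * w⁻¹) / P z (t * w⁻¹))) 0 1‖ ≤ C := by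
  obtain ⟨H, hH, hPH⟩ := hP.exists_slope
  rw [HasSlope.deriv_eq hH hPH] at h1
  set d := ‖H (z₀, 0, 0)‖ with hd
  have hdpos : 0 < d := norm_pos_iff.2 h1
  -- the quotient of `Q` by the divided difference of `P` is Lipschitz near the origin
  set Φ : ℂ × ℂ × ℂ → ℂ := fun p => Q p.1 p.2.1 / H p with hΦ
  have hQ3 : ContDiff ℂ 1 fun p : ℂ × ℂ × ℂ => Q p.1 p.2.1 :=
    hQ.contDiff.comp (contDiff_fst.prodMk (contDiff_fst.comp contDiff_snd))
  have hΦc : ContDiffAt ℂ 1 Φ (z₀, 0, 0) := hQ3.contDiffAt.div hH.contDiffAt h1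
  obtain ⟨K, T, hT, hLip⟩ := hΦc.exists_lipschitzOnWith
  have hHev : ∀ᶠ p in 𝓝 ((z₀, 0, 0) : ℂ × ℂ × ℂ), d / 2 < ‖H p‖ :=
    (hH.continuous.norm.tendsto _).eventually_const_lt (by rw [← hd]; linarith)
  set B := ‖Q z₀ 0‖ + 1 with hB
  have hQev : ∀ᶠ p in 𝓝 ((z₀, 0, 0) : ℂ × ℂ × ℂ), ‖Q p.1 p.2.1‖ < B :=
    (hQ3.continuous.norm.tendsto _).eventually_lt_const (by simp [hB])
  obtain ⟨ε, hε, hball⟩ := Metric.eventually_nhds_iff.1 (hHev.and (hQev.and hT))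
  set r := ε / 2 with hr
  have hrpos : 0 < r := by positivity
  have hPev : ∀ᶠ z in 𝓝 z₀, ‖P z 0‖ < r * d / 4 := by
    have hc : Continuous fun z => ‖P z 0‖ :=
      (hP.continuous.comp (Continuous.prodMk_left (0 : ℂ))).norm
    refine (hc.tendsto z₀).eventually_lt_const ?_
    rw [h0, norm_zero]; positivity
  refine ⟨r, hrpos, max (B / (r * d / 4)) ((A + K) + K), ?_⟩
  filter_upwards [hα, hPev, Metric.ball_mem_nhds z₀ hε] with z hαz hPz hz hPz0 t ht htr
  have hmem : ∀ s s' : ℂ, ‖s‖ ≤ r → ‖s'‖ ≤ r → d / 2 < ‖H (z, s, s')‖ ∧ ‖Q z s‖ < B ∧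
      (z, s, s') ∈ T := by
    intro s s' hs hs'
    have := hball (y := (z, s, s')) (by
      simp only [Prod.dist_eq, max_lt_iff, dist_zero_right]
      exact ⟨hz, by linarith, by linarith⟩)
    exact this
  have hts : ∀ w : ℂ, ‖w‖ = 1 → ‖(t : ℂ) * w⁻¹‖ = t := by
    intro w hw
    simp [hw, abs_of_pos ht]
  -- either `P z` has a zero `s'` in the disc `|s| ≤ r`, which can be split off, or the maximum
  -- principle bounds `Q z / P z` in the disc
  by_cases hroot : ∃ s', ‖s'‖ ≤ r ∧ P z s' = 0
  · obtain ⟨s', hs', hPs'⟩ := hroot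
    have hs0 : s' ≠ 0 := fun h => hPz0 (h ▸ hPs')
    have hfac : ∀ s, P z s = (s - s') * H (z, s, s') := fun s => by
      rw [← hPH, hPs', sub_zero]
    set g : ℂ → ℂ := fun s => Φ (z, s, s') with hg
    have hgL : ∀ s u, ‖s‖ ≤ r → ‖u‖ ≤ r → ‖g s - g u‖ ≤ K * ‖s - u‖ := by
      intro s u hs hu
      have := hLip.dist_le_mul _ (hmem s s' hs hs').2.2 _ (hmem u s' hu hs').2.2
      simpa [dist_eq_norm, Prod.norm_def] using this
    -- the residue is of the order of `s'`, since `Q z 0` is of the order of `P z 0`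
    have hg' : ‖g s'‖ ≤ (A + K) * ‖s'‖ := by
      have e1 : ‖g 0‖ ≤ A * ‖s'‖ := by
        have h2 := (hmem 0 s' (by simpa using hrpos.le) hs').1
        have h3 := hαz hPz0
        rw [hfac 0, norm_mul, zero_sub, norm_neg] at h3
        rw [hg, hΦ]
        simp only
        rw [norm_div, div_le_iff₀ (by linarith)]
        linarith
      have e2 := hgL s' 0 hs' (by simpa using hrpos.le)
      have e3 := norm_add_le (g s' - g 0) (g 0)
      rw [sub_add_cancel] at e3
      rw [sub_zero] at e2
      linarith
    have hmeas : Measurable g :=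
      (hQ.continuous_right z).measurable.div (hH.continuous.comp (by fun_prop)).measurable
    -- the integrand without its pole
    set h : ℂ → ℂ := fun w => w ^ (x - 1) *
      ((g (t * w⁻¹) - g s') / ((t : ℂ) * w⁻¹ - s')) with hh
    have hhm : Measurable h := by
      have : Measurable fun w : ℂ => g (t * w⁻¹) := hmeas.comp (by fun_prop)
      rw [hh]
      fun_prop
    have hhb : ∀ w, ‖w‖ = 1 → ‖h w‖ ≤ K := by
      intro w hw
      rw [hh]
      simp only [norm_mul, norm_zpow, hw, one_zpow, one_mul, norm_div]
      refine div_le_of_le_mul₀ (norm_nonneg _) K.2 ?_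
      exact hgL _ _ (by rw [hts w hw]; exact htr) hs'
    have hhi := circleIntegrable_of_bounded hhm hhb
    set ζ : ℂ := t / s' with hζ
    have heq : Set.EqOn (fun w : ℂ => (w - 0)⁻¹ • (w ^ x * (Q z (t * w⁻¹) / P z (t * w⁻¹))))
        (fun w => -(g s' / s') * (w ^ x * (w - ζ)⁻¹) + h w) (Metric.sphere 0 |1|) := by
      intro w hw
      have hw1 : ‖w‖ = 1 := by simpa using hw
      have hw0 : w ≠ 0 := by
        intro h; simp [h] at hw1
      have e1 : Q z (t * w⁻¹) / P z (t * w⁻¹) = g (t * w⁻¹) / ((t : ℂ) * w⁻¹ - s') := by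
        rw [hfac, hg, hΦ]
        simp only
        rw [div_div, mul_comm (H _)]
      have e2 : ((t : ℂ) * w⁻¹ - s')⁻¹ = -(w / s' * (w - ζ)⁻¹) := by
        rw [hζ, ← inv_inj, inv_neg, mul_inv, inv_inv, inv_inv]
        field_simp
        ring
      simp only [hh, sub_zero, smul_eq_mul, e1]
      rw [zpow_sub_one₀ hw0, sub_div, div_eq_mul_inv (g s') (_ - _), e2]
      field_simp
      ring
    rw [Real.circleAverage_eq_circleIntegral one_ne_zero]
    refine le_trans ?_ (le_max_right _ _)
    -- if the zero lies on the circle of integration, the integral is `0` by convention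
    by_cases hint : CircleIntegrable
      (fun w : ℂ => (w - 0)⁻¹ • (w ^ x * (Q z (t * w⁻¹) / P z (t * w⁻¹)))) 0 1
    swap
    · rw [circleIntegral.integral_undef hint, smul_zero, norm_zero]
      have := K.2
      positivity
    have hint2 : CircleIntegrable (fun w => -(g s' / s') * (w ^ x * (w - ζ)⁻¹)) 0 1 := by
      refine (circleIntegrable_congr ?_).1 (hint.sub hhi)
      intro w hw
      have h2 := heq hw
      simp only at h2
      simp only [Pi.sub_apply, h2, add_sub_cancel_right]
    rw [circleIntegral.integral_congr zero_le_one (by rw [abs_one] at heq; exact heq),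
      circleIntegral.integral_add hint2 hhi, circleIntegral.integral_const_mul, smul_add]
    refine (norm_add_le _ _).trans (add_le_add ?_ ?_)
    · have e1 := norm_circleIntegral_zpow_mul_inv_le x ζ
      have e2 : ‖g s' / s'‖ ≤ A + K := by
        rw [norm_div, div_le_iff₀ (norm_pos_iff.2 hs0)]
        exact hg'
      have e3 : ‖(2 * Real.pi * Complex.I : ℂ)⁻¹‖ = (2 * Real.pi)⁻¹ := by
        simp [abs_of_pos Real.pi_pos]
      rw [norm_smul, norm_mul, norm_neg, e3]
      have hpi : 0 < 2 * Real.pi := by positivity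
      calc (2 * Real.pi)⁻¹ * (‖g s' / s'‖ * ‖∮ w in C(0, 1), w ^ x * (w - ζ)⁻¹‖)
          ≤ (2 * Real.pi)⁻¹ * ((A + K) * (2 * Real.pi)) := by gcongr
        _ = A + K := by field_simp
    · have := circleIntegral.norm_two_pi_i_inv_smul_integral_le_of_norm_le_const (c := 0) (R := 1)
        (C := K) (f := h) zero_le_one (fun w hw => hhb w (by simpa using hw))
      simpa using this
  · push Not at hroot
    refine le_trans (norm_circleAverage_le fun w hw => ?_) (le_max_left _ _)
    rw [norm_mul, norm_zpow, hw, one_zpow, one_mul]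
    have hball0 : ∀ s ∈ closure (Metric.ball (0 : ℂ) r), ‖s‖ ≤ r := by
      intro s hs
      rw [closure_ball _ hrpos.ne'] at hs
      simpa using hs
    refine Complex.norm_le_of_forall_mem_frontier_norm_le (U := Metric.ball (0 : ℂ) r)
      (f := fun s => Q z s / P z s) Metric.isBounded_ball ?_ ?_ ?_
    · refine DifferentiableOn.diffContOnCl fun s hs => ?_
      exact ((hQ.differentiable_right z s).div (hP.differentiable_right z s)
        (hroot s (hball0 s hs))).differentiableWithinAt
    · intro s hs
      rw [frontier_ball _ hrpos.ne'] at hs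
      have hs' : ‖s‖ = r := by simpa using hs
      have e1 := hmem s 0 hs'.le (by simpa using hrpos.le)
      have e2 : P z s = P z 0 + s * H (z, s, 0) := by
        have := hPH z s 0
        rw [sub_zero] at this
        linear_combination this
      have e3 : r * d / 4 ≤ ‖P z s‖ := by
        have := norm_sub_le (P z s) (P z 0)
        rw [e2, add_sub_cancel_left, norm_mul, hs', ← e2] at this
        have e4 : r * (d / 2) ≤ r * ‖H (z, s, 0)‖ := by gcongr; exact e1.1.le
        linarith
      rw [norm_div]
      have : 0 < r * d / 4 := by positivity
      gcongr
      exact e1.2.1.le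
    · rw [closure_ball _ hrpos.ne']
      simpa only [Metric.mem_closedBall, dist_zero_right, hts w hw] using htr

/-! ### Limits and exact values of circle averages -/

lemma circleAverage_zpow (x : ℤ) :
    Real.circleAverage (fun w : ℂ => w ^ x) 0 1 = if x = 0 then 1 else 0 := by
  rw [Real.circleAverage_eq_circleIntegral one_ne_zero]
  have : (∮ w in C(0, 1), (w - 0)⁻¹ • w ^ x) = ∮ w in C(0, 1), w ^ (x - 1) := by
    refine circleIntegral.integral_congr zero_le_one fun w hw => ?_
    have hw0 : w ≠ 0 := fun h => by simp [h] at hw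
    simp only [sub_zero, smul_eq_mul]
    rw [zpow_sub_one₀ hw0, mul_comm]
  rw [this, circleIntegral_zpow, smul_eq_mul]
  have hx : x - 1 = -1 ↔ x = 0 := by omega
  simp only [hx]
  split_ifs
  · exact inv_mul_cancel₀ (by simp [Real.pi_ne_zero])
  · simp

/-- Dominated convergence for averages over the unit circle, up to a countable set. -/
lemma tendsto_circleAverage_of_dominated {ι : Type*} {l : Filter ι} [l.IsCountablyGenerated]
    {G : ι → ℂ → ℂ} {g : ℂ → ℂ} {S : Set ℂ} (hS : S.Countable) (C : ℝ)
    (hmeas : ∀ᶠ i in l, Measurable (G i))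
    (hb : ∀ᶠ i in l, ∀ w, ‖w‖ = 1 → w ∉ S → ‖G i w‖ ≤ C)
    (hlim : ∀ w, ‖w‖ = 1 → w ∉ S → Tendsto (fun i => G i w) l (𝓝 (g w))) :
    Tendsto (fun i => Real.circleAverage (G i) 0 1) l (𝓝 (Real.circleAverage g 0 1)) := by
  have hae : ∀ᵐ θ : ℝ, circleMap 0 1 θ ∉ S :=
    compl_mem_ae_iff.2 ((hS.preimage_circleMap 0 one_ne_zero).measure_zero _)
  simp only [Real.circleAverage_def]
  refine Tendsto.const_smul ?_ _
  refine intervalIntegral.tendsto_integral_filter_of_dominated_convergence (fun _ => C) ?_ ?_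
    intervalIntegrable_const ?_
  · filter_upwards [hmeas] with i hi
    exact (hi.comp (measurable_circleMap 0 1)).aestronglyMeasurable
  · filter_upwards [hb] with i hi
    filter_upwards [hae] with θ hθ _
    exact hi _ (by simp) hθ
  · filter_upwards [hae] with θ hθ _
    exact hlim _ (by simp) hθ

/-- In the limit `t → 0` only the value of `F` at the centre remains, as the constant term. -/
lemma tendsto_circleAverage_zpow_mul {F : ℂ → ℂ} (hF : Measurable F) (hc : ContinuousAt F 0)
    (x : ℤ) :
    Tendsto (fun t : ℝ => Real.circleAverage (fun w => w ^ x * F (t * w⁻¹)) 0 1) (𝓝[>] 0)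
      (𝓝 (if x = 0 then F 0 else 0)) := by
  have h0 : Real.circleAverage (fun w => w ^ x * F 0) 0 1 = if x = 0 then F 0 else 0 := by
    have := Real.circleAverage_fun_smul (a := F 0) (f := fun w : ℂ => w ^ x) (c := 0) (R := 1)
    simp only [smul_eq_mul, mul_comm (F 0)] at this
    rw [this, circleAverage_zpow]
    split_ifs <;> simp
  rw [← h0]
  have hb : ∀ᶠ s in 𝓝 (0 : ℂ), ‖F s‖ < ‖F 0‖ + 1 :=
    hc.norm.eventually_lt_const (by linarith [norm_nonneg (F 0)])
  obtain ⟨δ, hδ, hball⟩ := Metric.eventually_nhds_iff.1 hb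
  refine tendsto_circleAverage_of_dominated Set.countable_empty (‖F 0‖ + 1) ?_ ?_ ?_
  · refine Eventually.of_forall fun t => ?_
    have : Measurable fun w : ℂ => F (t * w⁻¹) := hF.comp (by fun_prop)
    fun_prop
  · filter_upwards [Ioo_mem_nhdsGT hδ] with t ht w hw _
    rw [norm_mul, norm_zpow, hw, one_zpow, one_mul]
    refine (hball ?_).le
    simp [hw, abs_of_pos ht.1, ht.2]
  · intro w _ _
    refine Tendsto.const_mul _ ?_
    have h1 : Tendsto (fun t : ℝ => (t : ℂ) * w⁻¹) (𝓝[>] 0) (𝓝 0) := by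
      have : Continuous fun t : ℝ => (t : ℂ) * w⁻¹ := by fun_prop
      have := this.tendsto 0
      simp only [Complex.ofReal_zero, zero_mul] at this
      exact this.mono_left nhdsWithin_le_nhds
    exact hc.tendsto.comp h1

/-- The mean value property on the circle `|s| = t`, parametrized by `w = t / s`. -/
lemma circleAverage_comp_mul_inv {F : ℂ → ℂ} {t : ℝ} (ht : 0 < t)
    (hF : ∀ s : ℂ, ‖s‖ ≤ t → DifferentiableAt ℂ F s) :
    Real.circleAverage (fun w => F (t * w⁻¹)) 0 1 = F 0 := by
  have h1 : DiffContOnCl ℂ F (Metric.ball 0 |t|) := by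
    refine DifferentiableOn.diffContOnCl fun s hs => ?_
    rw [abs_of_pos ht, closure_ball _ ht.ne'] at hs
    exact (hF s (by simpa using hs)).differentiableWithinAt
  have h2 := h1.circleAverage
  rw [Real.circleAverage_eq_circleAverage_zero_one] at h2
  rw [← h2, ← Real.circleAverage_zero_one_congr_inv]
  simp

lemma measurable_circleAverage_right {F : ℂ × ℂ → ℂ} (hF : Measurable F) :
    Measurable fun z => Real.circleAverage (fun w => F (z, w)) 0 1 := by
  simp only [Real.circleAverage_def, intervalIntegral.integral_of_le Real.two_pi_pos.le]
  refine Measurable.const_smul ?_ _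
  refine StronglyMeasurable.measurable ?_
  refine StronglyMeasurable.integral_prod_right
    (f := fun (z : ℂ) (θ : ℝ) => F (z, circleMap 0 1 θ)) ?_
  refine Measurable.stronglyMeasurable ?_
  exact hF.comp (measurable_fst.prodMk ((measurable_circleMap 0 1).comp measurable_snd))

/-- A tube lemma: on a compact set the zeros of `f z` keep a uniform distance from `0`. -/
lemma exists_radius_ne_zero {f : ℂ → ℂ → ℂ} (hf : Continuous fun p : ℂ × ℂ => f p.1 p.2)
    {K : Set ℂ} (hK : IsCompact K) (h : ∀ z ∈ K, f z 0 ≠ 0) :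
    ∃ r > 0, ∀ z ∈ K, ∀ s : ℂ, ‖s‖ < r → f z s ≠ 0 := by
  have hev : ∀ᶠ s in 𝓝 (0 : ℂ), ∀ z ∈ K, f z s ≠ 0 := by
    refine hK.eventually_forall_of_forall_eventually fun z hz => ?_
    have hc : Continuous fun p : ℂ × ℂ => f p.2 p.1 := hf.comp continuous_swap
    exact (isOpen_compl_singleton.preimage hc).mem_nhds (x := ((0 : ℂ), z)) (h z hz)
  obtain ⟨r, hr, h'⟩ := Metric.eventually_nhds_iff.1 hev
  exact ⟨r, hr, fun z hz s hs => h' (by simpa using hs) z hz⟩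

/-! ### The inverse Kasteleyn operator as an iterated average -/

section Torus

variable {m n : ℕ} (a b c : ZMod m → ZMod n → ℝ) (Bx : ℝ)

/-- The characteristic polynomial on the torus `|z| = 1`, in the variable `s` inverse to `w`. -/
noncomputable def torusDet [NeZero m] [NeZero n] (z s : ℂ) : ℂ :=
  (pencil a b c (Complex.exp Bx * z) s).det

/-- The cofactors on the torus `|z| = 1`, in the variable `s` inverse to `w`. -/
noncomputable def torusAdj [NeZero m] [NeZero n] (p q : ZMod m × ZMod n) (z s : ℂ) : ℂ :=
  (pencil a b c (Complex.exp Bx * z) s).adjugate p q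

/-- The integral over `w` in the definition of `invKasteleyn`, with `t = exp (-By)`. -/
noncomputable def innerAverage [NeZero m] [NeZero n] (p q : ZMod m × ZMod n) (x : ℤ) (t : ℝ)
    (z : ℂ) : ℂ :=
  Real.circleAverage
    (fun w => w ^ x * (torusAdj a b c Bx p q z (t * w⁻¹) / torusDet a b c Bx z (t * w⁻¹))) 0 1

/-- The inverse of the Kasteleyn matrix of column `j` alone, at a point of the circle `|z| = 1`. -/
noncomputable def columnInv [NeZero m] (j : ZMod n) (i l : ZMod m) (z : ℂ) : ℂ :=
  columnGreen a c j (Complex.exp Bx * z) i l / (1 - columnRatio a c j (Complex.exp Bx * z))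

/-- Where the determinant vanishes, both sides are `0` by convention. -/
lemma inv_pencil_apply [NeZero m] [NeZero n] (p q : ZMod m × ZMod n) (z s : ℂ) :
    (pencil a b c (Complex.exp Bx * z) s)⁻¹ p q =
      torusAdj a b c Bx p q z s / torusDet a b c Bx z s := by
  rw [Matrix.inv_def, Ring.inverse_eq_inv', Matrix.smul_apply, smul_eq_mul, torusAdj, torusDet,
    div_eq_inv_mul]

lemma invKasteleyn_eq [NeZero m] [NeZero n] (By : ℝ) (black white : ℤ × ℤ) :
    invKasteleyn a b c Bx By black white =
      Real.circleAverage (fun z => z ^ (-(black.2 / (m : ℤ) - white.2 / (m : ℤ))) *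
        innerAverage a b c Bx (vertexType m n black) (vertexType m n white)
          (black.1 / (n : ℤ) - white.1 / (n : ℤ)) (Real.exp (-By)) z) 0 1 := by
  rw [Real.circleAverage_eq_circleIntegral one_ne_zero, invKasteleyn]
  simp only [smul_eq_mul, sub_zero]
  congr 1
  refine congrArg (fun f : ℂ → ℂ => ∮ z in C(0, 1), f z) (funext fun z => ?_)
  congr 1
  rw [innerAverage, Real.circleAverage_eq_circleIntegral one_ne_zero, smul_eq_mul, mul_left_comm]
  congr 1
  rw [← circleIntegral.integral_const_mul]
  refine congrArg (fun f : ℂ → ℂ => ∮ z in C(0, 1), f z) (funext fun w => ?_)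
  have e : (Complex.exp By * w)⁻¹ = (Real.exp (-By) : ℝ) * w⁻¹ := by
    rw [mul_inv, ← Complex.exp_neg]
    push_cast
    rfl
  rw [kasteleyn_eq_pencil, e, inv_pencil_apply, sub_zero, smul_eq_mul]
  ring

variable {a b c}

lemma hasSlope_pencil (p q : ZMod m × ZMod n) :
    HasSlope fun z s => pencil a b c (Complex.exp Bx * z) s p q := by
  simp only [pencil, Matrix.of_apply]
  have h1 : HasSlope fun z _ => (Complex.exp Bx * z) := HasSlope.of_fst (by fun_prop)
  refine ((HasSlope.const _).add ?_).add ?_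
  · split_ifs
    · exact (HasSlope.const _).mul HasSlope.snd
    · exact HasSlope.const _
    · exact HasSlope.const _
  · split_ifs
    · exact (HasSlope.const _).mul h1
    · exact HasSlope.const _
    · exact HasSlope.const _

variable [NeZero m]

lemma prod_div_eq_exp_neg_threshold (ha : ∀ i j, 0 < a i j) (hc : ∀ i j, 0 < c i j) (j : ZMod n) :
    ∏ i, c i j / a i j = Real.exp (-threshold a c j) := by
  rw [threshold, ← Finset.sum_neg_distrib, Real.exp_sum]
  refine Finset.prod_congr rfl fun i _ => ?_
  rw [Real.exp_neg, Real.exp_log (div_pos (ha i j) (hc i j)), inv_div]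

lemma columnRatio_eq (ha : ∀ i j, 0 < a i j) (hc : ∀ i j, 0 < c i j) (j : ZMod n) (z : ℂ) :
    columnRatio a c j (Complex.exp Bx * z) =
      (-1) ^ m * z * (Real.exp (Bx - threshold a c j) : ℝ) := by
  have h := congrArg (fun r : ℝ => (r : ℂ)) (prod_div_eq_exp_neg_threshold ha hc j)
  push_cast at h
  rw [columnRatio, h]
  push_cast
  rw [sub_eq_add_neg, Complex.exp_add]
  ring

/-- A column is singular at some point of the circle only at its threshold. -/
lemma one_sub_columnRatio_ne_zero (ha : ∀ i j, 0 < a i j) (hc : ∀ i j, 0 < c i j) {j : ZMod n}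
    (hB : Bx ≠ threshold a c j) {z : ℂ} (hz : ‖z‖ = 1) :
    1 - columnRatio a c j (Complex.exp Bx * z) ≠ 0 := by
  intro h
  have h1 := congrArg norm (sub_eq_zero.1 h)
  rw [columnRatio_eq Bx ha hc, norm_mul, norm_mul, norm_pow, norm_neg, norm_one, one_pow, one_mul,
    hz, one_mul, Complex.norm_real, Real.norm_of_nonneg (Real.exp_pos _).le, eq_comm,
    Real.exp_eq_one_iff] at h1
  exact hB (sub_eq_zero.1 h1)

lemma continuousAt_columnInv (ha : ∀ i j, 0 < a i j) (hc : ∀ i j, 0 < c i j) {j : ZMod n}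
    (hB : Bx ≠ threshold a c j) (i l : ZMod m) {z : ℂ} (hz : ‖z‖ = 1) :
    ContinuousAt (columnInv a c Bx j i l) z := by
  have h1 : Continuous fun z => columnGreen a c j (Complex.exp Bx * z) i l :=
    (continuous_columnGreen j i l).comp (by fun_prop)
  have h2 : Continuous fun z => 1 - columnRatio a c j (Complex.exp Bx * z) :=
    continuous_const.sub ((continuous_columnRatio j).comp (by fun_prop))
  exact h1.continuousAt.div h2.continuousAt (one_sub_columnRatio_ne_zero Bx ha hc hB hz)

variable [NeZero n]

lemma hasSlope_torusDet : HasSlope (torusDet a b c Bx) := HasSlope.det (hasSlope_pencil Bx)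

lemma hasSlope_torusAdj (p q : ZMod m × ZMod n) : HasSlope (torusAdj a b c Bx p q) :=
  HasSlope.adjugate (hasSlope_pencil Bx) p q

lemma measurable_innerAverage (p q : ZMod m × ZMod n) (x : ℤ) (t : ℝ) :
    Measurable (innerAverage a b c Bx p q x t) := by
  have h1 := (hasSlope_torusAdj (a := a) (b := b) (c := c) Bx p q).continuous.measurable
  have h2 := (hasSlope_torusDet (a := a) (b := b) (c := c) Bx).continuous.measurable
  have h3 : Measurable fun p : ℂ × ℂ => (p.1, (t : ℂ) * p.2⁻¹) := by fun_prop
  refine measurable_circleAverage_right (F := fun p' : ℂ × ℂ => p'.2 ^ x *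
    (torusAdj a b c Bx p q p'.1 (t * p'.2⁻¹) / torusDet a b c Bx p'.1 (t * p'.2⁻¹))) ?_
  have h4 := h1.comp h3
  have h5 := h2.comp h3
  exact (measurable_snd.pow_const x).mul (h4.div h5)

lemma torusDet_zero_ne_zero_iff (ha : ∀ i j, 0 < a i j) (z : ℂ) :
    torusDet a b c Bx z 0 ≠ 0 ↔ ∀ j, 1 - columnRatio a c j (Complex.exp Bx * z) ≠ 0 :=
  det_pencil_zero_ne_zero_iff ha _

lemma countable_torusDet_zero (ha : ∀ i j, 0 < a i j) (hc : ∀ i j, 0 < c i j) :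
    {z : ℂ | torusDet a b c Bx z 0 = 0}.Countable := by
  have : {z : ℂ | torusDet a b c Bx z 0 = 0} ⊆
      ⋃ j, {z : ℂ | 1 - columnRatio a c j (Complex.exp Bx * z) = 0} := by
    intro z hz
    by_contra h
    simp only [Set.mem_iUnion, Set.mem_ofPred_eq, not_exists] at h
    exact (torusDet_zero_ne_zero_iff Bx ha z).2 h hz
  refine Set.Countable.mono this (Set.countable_iUnion fun j => Set.Subsingleton.countable ?_)
  intro z hz z' hz'
  simp only [Set.mem_ofPred_eq, columnRatio_eq Bx ha hc] at hz hz'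
  have h1 : ((Real.exp (Bx - threshold a c j) : ℝ) : ℂ) ≠ 0 := by
    exact_mod_cast (Real.exp_pos _).ne'
  have h2 : ((-1 : ℂ)) ^ m ≠ 0 := pow_ne_zero _ (by norm_num)
  have h3 : (-1) ^ m * z * (Real.exp (Bx - threshold a c j) : ℝ) =
      (-1) ^ m * z' * (Real.exp (Bx - threshold a c j) : ℝ) := by linear_combination hz' - hz
  exact mul_left_cancel₀ h2 (mul_right_cancel₀ h1 h3)

/-- Both sides are continuous in `z`, and they agree where no column is singular. -/
lemma deriv_torusDet (ha : ∀ i j, 0 < a i j) (hc : ∀ i j, 0 < c i j) (z : ℂ) :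
    deriv (torusDet a b c Bx z) 0 = firstCoeff a b c (Complex.exp Bx * z) := by
  have hd := (countable_torusDet_zero (b := b) Bx ha hc).dense_compl ℂ
  have hf : Continuous fun z => firstCoeff a b c (Complex.exp Bx * z) :=
    continuous_firstCoeff.comp (by fun_prop)
  have := Continuous.ext_on hd (hasSlope_torusDet (a := a) (b := b) (c := c) Bx).continuous_deriv hf
    (fun z hz => (hasDerivAt_det_pencil ha hc
      ((torusDet_zero_ne_zero_iff (b := b) Bx ha z).1 hz)).deriv)
  exact congrFun this z

/-- The zeros of `torusDet` on the circle at `s = 0` are simple in `s`: there all column ratios are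
positive, so that `firstCoeff` is a sum of terms of the same sign. -/
lemma deriv_torusDet_ne_zero (ha : ∀ i j, 0 < a i j) (hb : ∀ i j, 0 < b i j)
    (hc : ∀ i j, 0 < c i j) {z : ℂ} (hz : torusDet a b c Bx z 0 = 0) :
    deriv (torusDet a b c Bx z) 0 ≠ 0 := by
  rw [deriv_torusDet Bx ha hc]
  refine firstCoeff_ne_zero ha hb hc fun j => ?_
  have : ¬ ∀ j, 1 - columnRatio a c j (Complex.exp Bx * z) ≠ 0 := fun h =>
    (torusDet_zero_ne_zero_iff (b := b) Bx ha z).2 h hz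
  push Not at this
  obtain ⟨j', hj'⟩ := this
  rw [columnRatio_eq Bx ha hc] at hj' ⊢
  have h1 : ((Real.exp (Bx - threshold a c j') : ℝ) : ℂ) ≠ 0 := by
    exact_mod_cast (Real.exp_pos _).ne'
  refine ⟨(Real.exp (Bx - threshold a c j'))⁻¹ * Real.exp (Bx - threshold a c j),
    by positivity, ?_⟩
  have h2 : (-1) ^ m * z = ((Real.exp (Bx - threshold a c j') : ℝ) : ℂ)⁻¹ :=
    eq_inv_of_mul_eq_one_left (sub_eq_zero.1 hj').symm
  rw [h2, pow_zero, one_mul, Complex.ofReal_mul, Complex.ofReal_inv]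

/-- At `s = 0` the block of the inverse on column `j` is the inverse of the column alone. -/
lemma torusAdj_div_torusDet_zero (ha : ∀ i j, 0 < a i j) (hc : ∀ i j, 0 < c i j) {z : ℂ}
    (hz : torusDet a b c Bx z 0 ≠ 0) (j : ZMod n) (i l : ZMod m) :
    torusAdj a b c Bx (i, j) (l, j) z 0 / torusDet a b c Bx z 0 = columnInv a c Bx j i l z := by
  have hne := (torusDet_zero_ne_zero_iff Bx ha z).1 hz
  rw [← inv_pencil_apply]
  rw [columnInv]
  have hU : IsUnit (pencil a b c (Complex.exp Bx * z) 0).det := isUnit_iff_ne_zero.2 hz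
  set ζ := Complex.exp Bx * z with hζ
  set u : ZMod m × ZMod n → ℂ := fun p => (pencil a b c ζ 0)⁻¹ p (l, j) with hu
  have hKu : (pencil a b c ζ 0).mulVec u = Pi.single (l, j) 1 := by
    have : u = (pencil a b c ζ 0)⁻¹.mulVec (Pi.single (l, j) 1) := by
      ext p; rw [Matrix.mulVec_single_one]; rfl
    rw [this, Matrix.mulVec_mulVec, Matrix.mul_nonsing_inv _ hU, Matrix.one_mulVec]
  have hdet : ∀ j', (columnMatrix a c j' ζ).det ≠ 0 := fun j' => by
    rw [det_columnMatrix c ha]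
    exact mul_ne_zero (Finset.prod_ne_zero_iff.2 fun i _ => by exact_mod_cast (ha i j').ne')
      (hne j')
  -- the column `u` of the inverse vanishes on the columns of the lattice before column `j`
  have hzero : ∀ k : ℕ, ∀ j' : ZMod n, j'.val = k → k < j.val → ∀ i, u (i, j') = 0 := by
    intro k
    induction k with
    | zero =>
      intro j' hj' hlt i
      have h0 : j' = 0 := (ZMod.val_eq_zero j').1 hj'
      have hne : j' ≠ j := fun h => by rw [← h] at hlt; omega
      refine congrFun (Matrix.eq_zero_of_mulVec_eq_zero (hdet j') (v := fun i => u (i, j')) ?_) i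
      ext i
      have := congrFun hKu (i, j')
      rw [pencil_mulVec, Pi.single_apply, if_neg (fun h => hne (congrArg Prod.snd h))] at this
      simp only [h0, if_true, mul_zero, zero_mul, add_zero] at this
      rw [columnMatrix, cyclicBidiag_mulVec]
      simpa [h0] using this
    | succ k ih =>
      intro j' hj' hlt i
      have h0 : j' ≠ 0 := fun h => by rw [h, ZMod.val_zero] at hj'; omega
      have hne : j' ≠ j := fun h => by rw [← h] at hlt; omega
      have hv := val_sub_one_add_one h0
      refine congrFun (Matrix.eq_zero_of_mulVec_eq_zero (hdet j') (v := fun i => u (i, j')) ?_) i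
      ext i
      have := congrFun hKu (i, j')
      rw [pencil_mulVec, Pi.single_apply, if_neg (fun h => hne (congrArg Prod.snd h))] at this
      simp only [ih (j' - 1) (by omega) (by omega), mul_zero, add_zero] at this
      rw [columnMatrix, cyclicBidiag_mulVec]
      simpa using this
  have hcol : (columnMatrix a c j ζ).mulVec
      (fun i => u (i, j) - columnGreen a c j ζ i l / (1 - columnRatio a c j ζ)) = 0 := by
    ext i'
    rw [columnMatrix, cyclicBidiag_mulVec]
    have h1 := congrFun hKu (i', j)
    have h2 := columnGreen_eq ha hc j ζ i' l
    have h3 : (b i' j : ℂ) * (if j = 0 then 0 else 1) * u (i', j - 1) = 0 := by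
      by_cases h0 : j = 0
      · simp [h0]
      · have hv := val_sub_one_add_one h0
        rw [hzero _ (j - 1) rfl (by omega), mul_zero]
    rw [pencil_mulVec, Pi.single_apply] at h1
    simp only [h3, add_zero, Prod.mk.injEq, and_true] at h1
    have h4 := hne j
    have h5 : (a i' j : ℂ) * (columnGreen a c j ζ i' l / (1 - columnRatio a c j ζ)) +
        cMult c j ζ i' * (columnGreen a c j ζ (i' - 1) l / (1 - columnRatio a c j ζ)) =
        if i' = l then 1 else 0 := by
      rw [← mul_div_assoc, ← mul_div_assoc, ← add_div, h2]
      split_ifs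
      · exact div_self h4
      · exact zero_div _
    simp only [Pi.zero_apply]
    linear_combination h1 - h5
  exact sub_eq_zero.1 (congrFun (Matrix.eq_zero_of_mulVec_eq_zero (hdet j) hcol) i)

/-- The averages over `w` are bounded on the circle `|z| = 1`, uniformly in small `t`, also when
other columns are at their thresholds. -/
lemma exists_bound_innerAverage (ha : ∀ i j, 0 < a i j) (hb : ∀ i j, 0 < b i j)
    (hc : ∀ i j, 0 < c i j) {j : ZMod n} (hB : Bx ≠ threshold a c j) (i l : ZMod m) (x : ℤ) :
    ∃ r > 0, ∃ C, ∀ z, ‖z‖ = 1 → torusDet a b c Bx z 0 ≠ 0 → ∀ t : ℝ, 0 < t → t ≤ r →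
      ‖innerAverage a b c Bx (i, j) (l, j) x t z‖ ≤ C := by
  -- a local bound suffices, by compactness of the circle
  have hloc : ∀ ζ : ℂ, ‖ζ‖ = 1 → ∃ r > 0, ∃ C, ∀ᶠ z in 𝓝 ζ, torusDet a b c Bx z 0 ≠ 0 →
      ∀ t : ℝ, 0 < t → t ≤ r → ‖innerAverage a b c Bx (i, j) (l, j) x t z‖ ≤ C := by
    intro ζ hζ
    by_cases h0 : torusDet a b c Bx ζ 0 = 0
    · refine exists_bound_circleAverage_of_simple_zero (hasSlope_torusDet Bx)
        (hasSlope_torusAdj Bx (i, j) (l, j)) h0 (deriv_torusDet_ne_zero Bx ha hb hc h0)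
        (A := ‖columnInv a c Bx j i l ζ‖ + 1) (by positivity) ?_ x
      filter_upwards [(continuousAt_columnInv Bx ha hc hB i l hζ).norm.eventually_lt_const
        (lt_add_one _)] with z hz hz0
      rw [← div_le_iff₀ (norm_pos_iff.2 hz0), ← norm_div,
        torusAdj_div_torusDet_zero Bx ha hc hz0]
      exact hz.le
    · set F : ℂ × ℂ → ℂ := fun p => torusAdj a b c Bx (i, j) (l, j) p.1 p.2 /
        torusDet a b c Bx p.1 p.2 with hF
      have hc : ContinuousAt F (ζ, 0) :=
        (hasSlope_torusAdj Bx (i, j) (l, j)).continuous.continuousAt.div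
        (hasSlope_torusDet Bx).continuous.continuousAt h0
      obtain ⟨ε, hε, hball⟩ := Metric.eventually_nhds_iff.1
        (hc.norm.eventually_lt_const (lt_add_one _))
      refine ⟨ε / 2, by positivity, ‖F (ζ, 0)‖ + 1, ?_⟩
      filter_upwards [Metric.ball_mem_nhds ζ hε] with z hz _ t ht htr
      refine norm_circleAverage_le fun w hw => ?_
      rw [norm_mul, norm_zpow, hw, one_zpow, one_mul]
      refine (hball (y := (z, (t : ℂ) * w⁻¹)) ?_).le
      simp only [Prod.dist_eq, max_lt_iff, dist_zero_right]
      refine ⟨hz, ?_⟩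
      simp only [norm_mul, norm_inv, hw, inv_one, mul_one, Complex.norm_real,
        Real.norm_of_nonneg ht.le]
      linarith
  have hK := isCompact_sphere (0 : ℂ) 1
  have := hK.induction_on (p := fun S => ∃ r > 0, ∃ C, ∀ z ∈ S, torusDet a b c Bx z 0 ≠ 0 →
      ∀ t : ℝ, 0 < t → t ≤ r → ‖innerAverage a b c Bx (i, j) (l, j) x t z‖ ≤ C)
    ⟨1, one_pos, 0, by simp⟩
    (fun S T hST ⟨r, hr, C, h⟩ => ⟨r, hr, C, fun z hz => h z (hST hz)⟩)
    (fun S T ⟨r, hr, C, h⟩ ⟨r', hr', C', h'⟩ => ⟨min r r', lt_min hr hr', max C C', by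
      rintro z (hz | hz) h0 t ht htr
      · exact (h z hz h0 t ht (htr.trans (min_le_left _ _))).trans (le_max_left _ _)
      · exact (h' z hz h0 t ht (htr.trans (min_le_right _ _))).trans (le_max_right _ _)⟩)
    (fun ζ hζ => by
      obtain ⟨r, hr, C, h⟩ := hloc ζ (by simpa using hζ)
      exact ⟨_, mem_nhdsWithin_of_mem_nhds h, r, hr, C, fun z hz => hz⟩)
  obtain ⟨r, hr, C, h⟩ := this
  exact ⟨r, hr, C, fun z hz => h z (by simpa using hz)⟩

variable (a c)

/-- The inverse of the operator of a single infinite column of type `j`, between the black vertex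
at height `Y` and the white vertex at height `Y'`. -/
noncomputable def columnKernel (j : ZMod n) (Y Y' : ℤ) : ℂ :=
  Real.circleAverage (fun z => z ^ (-(Y / (m : ℤ) - Y' / (m : ℤ))) *
    columnInv a c Bx j (Y : ZMod m) (Y' : ZMod m) z) 0 1

variable {a c}

lemma tendsto_exp_neg_nhdsGT : Tendsto (fun By : ℝ => Real.exp (-By)) atTop (𝓝[>] 0) :=
  tendsto_nhdsWithin_iff.2 ⟨Real.tendsto_exp_neg_atTop_nhds_zero,
    Eventually.of_forall fun _ => Real.exp_pos _⟩

/-- As the `b`-edges between the fundamental domains are suppressed, the inverse operator between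
columns of type `j` tends to the one of a single column. -/
lemma tendsto_invKasteleyn (ha : ∀ i j, 0 < a i j) (hb : ∀ i j, 0 < b i j)
    (hc : ∀ i j, 0 < c i j) {j : ZMod n} (hB : Bx ≠ threshold a c j) {black white : ℤ × ℤ}
    (h1 : (black.1 : ZMod n) = j) (h2 : (white.1 : ZMod n) = j) :
    Tendsto (fun By => invKasteleyn a b c Bx By black white) atTop
      (𝓝 (if black.1 / (n : ℤ) - white.1 / (n : ℤ) = 0 then columnKernel a c Bx j black.2 white.2
        else 0)) := by
  set x := black.1 / (n : ℤ) - white.1 / (n : ℤ) with hx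
  set y := black.2 / (m : ℤ) - white.2 / (m : ℤ) with hy
  have ht1 : vertexType m n black = ((black.2 : ZMod m), j) := by rw [vertexType, h1]
  have ht2 : vertexType m n white = ((white.2 : ZMod m), j) := by rw [vertexType, h2]
  obtain ⟨r, hr, C, hC⟩ := exists_bound_innerAverage Bx ha hb hc hB (black.2 : ZMod m)
    (white.2 : ZMod m) x
  have hlim : (if x = 0 then columnKernel a c Bx j black.2 white.2 else 0) =
      Real.circleAverage (fun z => z ^ (-y) *
        (if x = 0 then columnInv a c Bx j (black.2 : ZMod m) (white.2 : ZMod m) z else 0)) 0 1 := by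
    split_ifs
    · rfl
    · simp [Real.circleAverage_def]
  have key : Tendsto (fun t : ℝ => Real.circleAverage (fun z => z ^ (-y) *
      innerAverage a b c Bx ((black.2 : ZMod m), j) ((white.2 : ZMod m), j) x t z) 0 1) (𝓝[>] 0)
      (𝓝 (if x = 0 then columnKernel a c Bx j black.2 white.2 else 0)) := by
    rw [hlim]
    refine tendsto_circleAverage_of_dominated (countable_torusDet_zero (b := b) Bx ha hc) C ?_ ?_ ?_
    · refine Eventually.of_forall fun t => ?_
      have := measurable_innerAverage (a := a) (b := b) (c := c) Bx ((black.2 : ZMod m), j)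
        ((white.2 : ZMod m), j) x t
      fun_prop
    · filter_upwards [Ioc_mem_nhdsGT hr] with t ht z hz hz0
      rw [norm_mul, norm_zpow, hz, one_zpow, one_mul]
      exact hC z hz hz0 t ht.1 ht.2
    · intro z hz hz0
      refine Tendsto.const_mul _ ?_
      have hA := hasSlope_torusAdj (a := a) (b := b) (c := c) Bx ((black.2 : ZMod m), j)
        ((white.2 : ZMod m), j)
      have hD := hasSlope_torusDet (a := a) (b := b) (c := c) Bx
      rw [← torusAdj_div_torusDet_zero Bx ha hc hz0]
      exact tendsto_circleAverage_zpow_mul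
        ((hA.continuous_right z).measurable.div (hD.continuous_right z).measurable)
        ((hA.continuous_right z).continuousAt.div (hD.continuous_right z).continuousAt hz0) x
  refine (key.comp tendsto_exp_neg_nhdsGT).congr fun By => ?_
  rw [invKasteleyn_eq, ht1, ht2]
  rfl

/-- Away from all the thresholds the inverse operator within a column is already equal to the one
of a single column for large `By`. -/
lemma eventually_invKasteleyn_eq (ha : ∀ i j, 0 < a i j)
    (hc : ∀ i j, 0 < c i j) (hB : ∀ j, Bx ≠ threshold a c j) :
    ∀ᶠ By in atTop, ∀ (j : ZMod n) (X Y Y' : ℤ), (X : ZMod n) = j →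
      invKasteleyn a b c Bx By (X, Y) (X, Y') = columnKernel a c Bx j Y Y' := by
  have hne : ∀ z : ℂ, ‖z‖ = 1 → torusDet a b c Bx z 0 ≠ 0 := fun z hz =>
    (torusDet_zero_ne_zero_iff Bx ha z).2 fun j =>
      one_sub_columnRatio_ne_zero Bx ha hc (hB j) hz
  have hD := hasSlope_torusDet (a := a) (b := b) (c := c) Bx
  obtain ⟨r, hr, hrD⟩ : ∃ r > 0, ∀ z : ℂ, ‖z‖ = 1 → ∀ s : ℂ, ‖s‖ < r →
      torusDet a b c Bx z s ≠ 0 := by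
    obtain ⟨r, hr, h⟩ := exists_radius_ne_zero hD.continuous (isCompact_sphere (0 : ℂ) 1)
      fun z hz => hne z (by simpa using hz)
    exact ⟨r, hr, fun z hz => h z (by simpa using hz)⟩
  filter_upwards [tendsto_exp_neg_nhdsGT (Ioo_mem_nhdsGT hr)] with By hBy j X Y Y' hX
  have ht : Real.exp (-By) < r := hBy.2
  rw [invKasteleyn_eq, columnKernel]
  simp only [vertexType, hX, sub_self]
  refine Real.circleAverage_congr_sphere fun z hz => ?_
  have hz1 : ‖z‖ = 1 := by simpa using hz
  congr 1
  have hA := hasSlope_torusAdj (a := a) (b := b) (c := c) Bx ((Y : ZMod m), j) ((Y' : ZMod m), j)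
  rw [innerAverage, ← torusAdj_div_torusDet_zero Bx ha hc (hne z hz1)]
  simp only [zpow_zero, one_mul]
  exact circleAverage_comp_mul_inv (F := fun s =>
    torusAdj a b c Bx ((Y : ZMod m), j) ((Y' : ZMod m), j) z s / torusDet a b c Bx z s)
    (Real.exp_pos _) fun s hs => ((hA.differentiable_right z) s).div ((hD.differentiable_right z) s)
      (hrD z hz1 s (hs.trans_lt ht))

end Torus

/-! ### The kernel of a single column -/

section Kernel

variable {m n : ℕ} {a b c : ZMod m → ZMod n → ℝ} (Bx : ℝ)

variable (c) in
/-- The weight of the `c`-edge at height `Y` in column `j`, in the field `Bx`. -/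
noncomputable def cWeight (j : ZMod n) (Y : ℤ) : ℝ :=
  c (Y : ZMod m) j * (if (Y : ZMod m) = 0 then Real.exp Bx else 1)

lemma cWeight_pos (hc : ∀ i j, 0 < c i j) (j : ZMod n) (Y : ℤ) : 0 < cWeight c Bx j Y := by
  rw [cWeight]
  split_ifs
  · exact mul_pos (hc _ _) (Real.exp_pos _)
  · simpa using hc _ _

variable [NeZero m]

lemma int_sub_one_ediv (Y : ℤ) :
    (Y - 1) / (m : ℤ) = if (Y : ZMod m) = 0 then Y / (m : ℤ) - 1 else Y / (m : ℤ) := by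
  have hm : (0 : ℤ) < m := by exact_mod_cast NeZero.pos m
  have h1 := Int.emod_add_mul_ediv Y m
  have h2 := Int.emod_nonneg Y hm.ne'
  have h3 := Int.emod_lt_of_pos Y hm
  split_ifs with h
  · rw [ZMod.intCast_zmod_eq_zero_iff_dvd, Int.dvd_iff_emod_eq_zero] at h
    rw [Int.ediv_eq_iff_of_pos hm]
    constructor <;> nlinarith
  · rw [ZMod.intCast_zmod_eq_zero_iff_dvd, Int.dvd_iff_emod_eq_zero] at h
    have : 1 ≤ Y % m := by omega
    rw [Int.ediv_eq_iff_of_pos hm]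
    constructor <;> nlinarith

lemma int_eq_of_ediv_eq {N : ℕ} {Y Y' : ℤ} (h1 : (Y : ZMod N) = (Y' : ZMod N))
    (h2 : Y / (N : ℤ) = Y' / (N : ℤ)) : Y = Y' := by
  rw [ZMod.intCast_eq_intCast_iff'] at h1
  rw [← Int.emod_add_mul_ediv Y N, ← Int.emod_add_mul_ediv Y' N, h1, h2]

lemma continuousOn_zpow_sphere (k : ℤ) :
    ContinuousOn (fun z : ℂ => z ^ k) (Metric.sphere 0 1) := fun z hz =>
  (continuousAt_zpow₀ z k (Or.inl fun h => by simp [h] at hz)).continuousWithinAt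

/-- The kernel is inverse to the operator of the infinite column. -/
lemma columnKernel_rec (ha : ∀ i j, 0 < a i j) (hc : ∀ i j, 0 < c i j) {j : ZMod n}
    (hB : Bx ≠ threshold a c j) (Y Y' : ℤ) :
    (a (Y : ZMod m) j : ℂ) * columnKernel a c Bx j Y Y' +
      (cWeight c Bx j Y : ℂ) * columnKernel a c Bx j (Y - 1) Y' = if Y = Y' then 1 else 0 := by
  have hint : ∀ Y : ℤ, CircleIntegrable (fun z => z ^ (-(Y / (m : ℤ) - Y' / (m : ℤ))) *
      columnInv a c Bx j (Y : ZMod m) (Y' : ZMod m) z) 0 1 := fun Y =>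
    ((continuousOn_zpow_sphere _).mul fun z hz => (continuousAt_columnInv Bx ha hc hB _ _
      (by simpa using hz)).continuousWithinAt).circleIntegrable zero_le_one
  have hlin : ∀ (k : ℂ) (f : ℂ → ℂ), k * Real.circleAverage f 0 1 =
      Real.circleAverage (fun z => k * f z) 0 1 := fun k f =>
    (Real.circleAverage_fun_smul (a := k) (f := f) (c := 0) (R := 1)).symm
  rw [columnKernel, columnKernel, hlin, hlin, ← Real.circleAverage_fun_add]
  rotate_left
  · exact (hint Y).const_smul (a := (a (Y : ZMod m) j : ℂ))
  · exact (hint (Y - 1)).const_smul (a := (cWeight c Bx j Y : ℂ))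
  have hcongr : Set.EqOn (fun z : ℂ => (a (Y : ZMod m) j : ℂ) *
      (z ^ (-(Y / (m : ℤ) - Y' / (m : ℤ))) * columnInv a c Bx j (Y : ZMod m) (Y' : ZMod m) z) +
      (cWeight c Bx j Y : ℂ) * (z ^ (-((Y - 1) / (m : ℤ) - Y' / (m : ℤ))) *
        columnInv a c Bx j ((Y - 1 : ℤ) : ZMod m) (Y' : ZMod m) z))
      (fun z => if (Y : ZMod m) = (Y' : ZMod m) then z ^ (-(Y / (m : ℤ) - Y' / (m : ℤ))) else 0)
      (Metric.sphere 0 |1|) := by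
    intro z hz
    have hz1 : ‖z‖ = 1 := by simpa using hz
    have hz0 : z ≠ 0 := fun h => by simp [h] at hz1
    have h1 := columnGreen_eq ha hc j (Complex.exp Bx * z) (Y : ZMod m) (Y' : ZMod m)
    have h2 := one_sub_columnRatio_ne_zero Bx ha hc hB hz1
    have h3 : (cWeight c Bx j Y : ℂ) * z ^ (-((Y - 1) / (m : ℤ) - Y' / (m : ℤ))) =
        z ^ (-(Y / (m : ℤ) - Y' / (m : ℤ))) * cMult c j (Complex.exp Bx * z) (Y : ZMod m) := by
      rw [cWeight, cMult, int_sub_one_ediv]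
      split_ifs with h
      · rw [show -(Y / (m : ℤ) - 1 - Y' / (m : ℤ)) = -(Y / (m : ℤ) - Y' / (m : ℤ)) + 1 by ring,
          zpow_add_one₀ hz0]
        push_cast
        ring
      · push_cast
        ring
    simp only
    rw [← mul_assoc (cWeight c Bx j Y : ℂ), h3, columnInv, columnInv, Int.cast_sub, Int.cast_one]
    have h4 : (if (Y : ZMod m) = (Y' : ZMod m) then z ^ (-(Y / (m : ℤ) - Y' / (m : ℤ))) else 0) =
        z ^ (-(Y / (m : ℤ) - Y' / (m : ℤ))) * ((if (Y : ZMod m) = (Y' : ZMod m) then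
          1 - columnRatio a c j (Complex.exp Bx * z) else 0) /
          (1 - columnRatio a c j (Complex.exp Bx * z))) := by
      split_ifs
      · rw [div_self h2, mul_one]
      · simp
    rw [h4, ← h1]
    ring
  rw [Real.circleAverage_congr_sphere hcongr]
  by_cases h : (Y : ZMod m) = (Y' : ZMod m)
  · simp only [if_pos h]
    rw [circleAverage_zpow]
    refine if_congr ⟨fun h' => int_eq_of_ediv_eq h (by omega), fun h' => by simp [h']⟩ rfl rfl
  · simp only [if_neg h]
    rw [if_neg fun h' => h (by rw [h'])]
    simp [Real.circleAverage_def]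

/-- The bound is uniform in `Y`, since `|z| = 1` and `columnInv` depends on `Y` modulo `m` only. -/
lemma exists_bound_columnKernel (ha : ∀ i j, 0 < a i j) (hc : ∀ i j, 0 < c i j) {j : ZMod n}
    (hB : Bx ≠ threshold a c j) (Y' : ℤ) : ∃ C, ∀ Y, ‖columnKernel a c Bx j Y Y'‖ ≤ C := by
  have h : ∀ i : ZMod m, ∃ C, ∀ z ∈ Metric.sphere (0 : ℂ) 1,
      ‖columnInv a c Bx j i (Y' : ZMod m) z‖ ≤ C := fun i =>
    (isCompact_sphere (0 : ℂ) 1).exists_bound_of_continuousOn fun z hz =>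
      (continuousAt_columnInv Bx ha hc hB i _ (by simpa using hz)).continuousWithinAt
  choose C hC using h
  obtain ⟨M, hM⟩ := Finite.exists_le C
  refine ⟨M, fun Y => norm_circleAverage_le fun z hz => ?_⟩
  rw [norm_mul, norm_zpow, hz, one_zpow, one_mul]
  exact (hC _ z (by simpa using hz)).trans (hM _)

/-- Over a period away from the diagonal, the kernel is multiplied by a factor which depends only
on the distance of `Bx` to the threshold. -/
lemma norm_columnKernel_eq (ha : ∀ i j, 0 < a i j) (hc : ∀ i j, 0 < c i j) {j : ZMod n}
    (hB : Bx ≠ threshold a c j) {Y Y' : ℤ} (h : ∀ k : ℕ, k < m → Y - k ≠ Y') :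
    ‖columnKernel a c Bx j Y Y'‖ =
      Real.exp (Bx - threshold a c j) * ‖columnKernel a c Bx j (Y - m) Y'‖ := by
  set ρ : ZMod m → ℝ := fun i => c i j * (if i = 0 then Real.exp Bx else 1) / a i j with hρ
  have hstep : ∀ Y, Y ≠ Y' → ‖columnKernel a c Bx j Y Y'‖ =
      ρ (Y : ZMod m) * ‖columnKernel a c Bx j (Y - 1) Y'‖ := by
    intro Y hY
    have h1 := columnKernel_rec Bx ha hc hB Y Y'
    rw [if_neg hY, add_eq_zero_iff_eq_neg] at h1
    have h2 := congrArg norm h1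
    rw [norm_neg, norm_mul, norm_mul, Complex.norm_real, Complex.norm_real,
      Real.norm_of_nonneg (ha _ _).le, Real.norm_of_nonneg (cWeight_pos Bx hc j Y).le] at h2
    have h3 := (ha (Y : ZMod m) j).ne'
    have h4 : ρ (Y : ZMod m) = cWeight c Bx j Y / a (Y : ZMod m) j := rfl
    rw [h4, div_mul_eq_mul_div, eq_div_iff h3, ← h2, mul_comm]
  have hiter : ∀ N : ℕ, N ≤ m → ‖columnKernel a c Bx j Y Y'‖ =
      (∏ k ∈ Finset.range N, ρ ((Y - k : ℤ) : ZMod m)) * ‖columnKernel a c Bx j (Y - N) Y'‖ := by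
    intro N
    induction N with
    | zero => intro _; simp
    | succ N ih =>
      intro hN
      rw [ih (by omega), hstep (Y - N) (h N (by omega)), Finset.prod_range_succ, mul_assoc]
      push_cast
      rw [sub_sub]
  have hprod : ∏ k ∈ Finset.range m, ρ ((Y - k : ℤ) : ZMod m) =
      Real.exp (Bx - threshold a c j) := by
    have h1 := prod_zmod_eq_prod_range (fun i : ZMod m => ρ ((Y : ZMod m) - i))
    push_cast at h1 ⊢
    have h2 := Equiv.prod_comp (Equiv.subLeft (Y : ZMod m)) ρ
    simp only [Equiv.subLeft_apply] at h2
    rw [← h1, h2, hρ, sub_eq_add_neg, Real.exp_add,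
      ← prod_div_eq_exp_neg_threshold ha hc]
    simp only [mul_div_right_comm, Finset.prod_mul_distrib, Finset.prod_ite_eq', Finset.mem_univ,
      if_true]
    rw [mul_comm]
  rw [hiter m le_rfl, hprod]

/-- Below the threshold the recursion makes the kernel grow exponentially as `Y → -∞`, unless it is
zero there. -/
lemma columnKernel_eq_zero_of_lt (ha : ∀ i j, 0 < a i j) (hc : ∀ i j, 0 < c i j) {j : ZMod n}
    (hB : Bx < threshold a c j) {Y Y' : ℤ} (hY : Y < Y') : columnKernel a c Bx j Y Y' = 0 := by
  obtain ⟨C, hC⟩ := exists_bound_columnKernel Bx ha hc hB.ne Y'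
  set q := Real.exp (Bx - threshold a c j) with hq
  have hq1 : q < 1 := by simpa [hq] using hB
  have hiter : ∀ N : ℕ, ‖columnKernel a c Bx j Y Y'‖ =
      q ^ N * ‖columnKernel a c Bx j (Y - N * m) Y'‖ := by
    intro N
    induction N with
    | zero => simp
    | succ N ih =>
      have : (0 : ℤ) ≤ N * m := by positivity
      rw [ih, norm_columnKernel_eq Bx ha hc hB.ne (fun k _ => by omega), ← hq, pow_succ, mul_assoc,
        show Y - N * (m : ℤ) - m = Y - (N + 1 : ℕ) * (m : ℤ) by push_cast; ring]
  have hle : ∀ N : ℕ, ‖columnKernel a c Bx j Y Y'‖ ≤ q ^ N * C := fun N => by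
    rw [hiter N]
    gcongr
    exact hC _
  have hlim : Tendsto (fun N : ℕ => q ^ N * C) atTop (𝓝 0) := by
    simpa using (tendsto_pow_atTop_nhds_zero_of_lt_one (Real.exp_pos _).le hq1).mul_const C
  exact norm_le_zero_iff.1 (ge_of_tendsto' hlim hle)

/-- Above the threshold the recursion makes the kernel grow exponentially as `Y → +∞`, unless it is
zero there. -/
lemma columnKernel_eq_zero_of_ge (ha : ∀ i j, 0 < a i j) (hc : ∀ i j, 0 < c i j) {j : ZMod n}
    (hB : threshold a c j < Bx) {Y Y' : ℤ} (hY : Y' ≤ Y) : columnKernel a c Bx j Y Y' = 0 := by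
  obtain ⟨C, hC⟩ := exists_bound_columnKernel Bx ha hc hB.ne' Y'
  set q := Real.exp (Bx - threshold a c j) with hq
  have hqpos : 0 < q := Real.exp_pos _
  have hq1 : 1 < q := Real.one_lt_exp_iff.2 (by linarith)
  have hiter : ∀ N : ℕ, ‖columnKernel a c Bx j (Y + N * m) Y'‖ =
      q ^ N * ‖columnKernel a c Bx j Y Y'‖ := by
    intro N
    induction N with
    | zero => simp
    | succ N ih =>
      have : (0 : ℤ) ≤ N * m := by positivity
      rw [norm_columnKernel_eq Bx ha hc hB.ne' (fun k hk => by push_cast; nlinarith), ← hq,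
        pow_succ', mul_assoc, ← ih,
        show Y + (N + 1 : ℕ) * (m : ℤ) - m = Y + N * (m : ℤ) by push_cast; ring]
  have hle : ∀ N : ℕ, ‖columnKernel a c Bx j Y Y'‖ ≤ q⁻¹ ^ N * C := fun N => by
    have h1 := hC (Y + N * m)
    rw [hiter N] at h1
    rw [inv_pow, ← div_eq_inv_mul, le_div_iff₀ (by positivity), mul_comm]
    exact h1
  have hlim : Tendsto (fun N : ℕ => q⁻¹ ^ N * C) atTop (𝓝 0) := by
    simpa using (tendsto_pow_atTop_nhds_zero_of_lt_one (by positivity)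
      (inv_lt_one_of_one_lt₀ hq1)).mul_const C
  exact norm_le_zero_iff.1 (ge_of_tendsto' hlim hle)

end Kernel

/-! ### From the kernel to the dimer measures -/

/-- A matrix which is lower triangular for the order pulled back along an injection. -/
lemma det_eq_prod_diag_of_injective {ι α : Type*} [Fintype ι] [DecidableEq ι] [LinearOrder α]
    {M : Matrix ι ι ℂ} {g : ι → α} (hg : Function.Injective g)
    (h : ∀ i j, g i < g j → M i j = 0) : M.det = ∏ i, M i i := by
  let : LinearOrder ι := LinearOrder.lift' g hg
  have h1 : M.BlockTriangular OrderDual.toDual := fun i j hij => h i j hij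
  convert! Matrix.det_of_isLowerTriangular M h1

lemma measurableSet_mem_config (e : Edge) : MeasurableSet {C : DimerConfig | e ∈ C.1} := by
  have h : Measurable fun C : DimerConfig => C.1 := measurable_subtype_coe
  exact measurableSet_setOfPred.2 ((measurable_set_mem e).comp h)

section Filled

variable {m n : ℕ} {a b c : ZMod m → ZMod n → ℝ} {Bx : ℝ} [NeZero m] [NeZero n]

/-- The columns are filled by edges of kind `κ` as soon as the kernel of the column is triangular
along these edges, with the inverses of the edge weights on the diagonal. The function `σ` gives
the order of the heights for which it is triangular. -/
lemma columnsFilled_of_kernel (ha : ∀ i j, 0 < a i j) (hb : ∀ i j, 0 < b i j)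
    (hc : ∀ i j, 0 < c i j) {j : ZMod n} (hB : Bx ≠ threshold a c j) {κ : EdgeType}
    (hκ : ∀ v : ℤ × ℤ, (Edge.black ⟨v, κ⟩).1 = v.1)
    (hdiag : ∀ (v : ℤ × ℤ) (By : ℝ), (v.1 : ZMod n) = j →
      (edgeWeight a b c Bx By ⟨v, κ⟩ : ℂ) *
        columnKernel a c Bx j (Edge.black ⟨v, κ⟩).2 v.2 = 1)
    (σ : ℤ → ℤ) (hσ : Function.Injective σ)
    (htri : ∀ v v' : ℤ × ℤ, σ v.2 < σ v'.2 →
      columnKernel a c Bx j (Edge.black ⟨v, κ⟩).2 v'.2 = 0) :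
    ColumnsFilled a b c Bx j κ := by
  have hstat : ∀ W : Finset Edge, (∀ e ∈ W, e.kind = κ ∧ (e.white.1 : ZMod n) = j) →
      Tendsto (fun By : ℝ => localStat a b c Bx By W) atTop (𝓝 1) := by
    intro W hW
    have hW' : ∀ e : W, (e : Edge) = ⟨(e : Edge).white, κ⟩ := fun e => by
      have := (hW e e.2).1
      rcases e with ⟨⟨v, k⟩, he⟩
      simp only at this
      simp [this]
    have hcol : ∀ e : W, ((e : Edge).black.1 : ZMod n) = j := fun e => by
      rw [hW' e, hκ]; exact (hW e e.2).2
    set M : Matrix W W ℂ := Matrix.of fun e f =>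
      if e.1.black.1 / (n : ℤ) - f.1.white.1 / (n : ℤ) = 0 then
        columnKernel a c Bx j e.1.black.2 f.1.white.2 else 0 with hM
    have hMdet : M.det = ∏ e, M e e := by
      refine det_eq_prod_diag_of_injective
        (g := fun e : W => toLex (e.1.white.1, σ e.1.white.2)) ?_ ?_
      · intro e f hef
        have h1 := congrArg ofLex hef
        simp only [ofLex_toLex, Prod.mk.injEq] at h1
        have h2 : e.1.white = f.1.white := Prod.ext h1.1 (hσ h1.2)
        exact Subtype.ext (by rw [hW' e, hW' f, h2])
      · intro e f hef
        simp only [hM, Matrix.of_apply]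
        have hb1 : e.1.black.1 = e.1.white.1 := by
          conv_lhs => rw [hW' e]
          exact hκ _
        split_ifs with h
        · have h3 : e.1.white.1 = f.1.white.1 := int_eq_of_ediv_eq
            ((hW e e.2).2.trans (hW f f.2).2.symm) (by rw [hb1] at h; omega)
          rw [Prod.Lex.toLex_lt_toLex] at hef
          rcases hef with h4 | ⟨-, h4⟩
          · exact absurd h3 (ne_of_lt h4)
          · conv_lhs => rw [hW' e]
            exact htri _ _ h4
        · rfl
    have hentry : ∀ e f : W, Tendsto
        (fun By => invKasteleyn a b c Bx By e.1.black f.1.white) atTop (𝓝 (M e f)) :=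
      fun e f => tendsto_invKasteleyn Bx ha hb hc hB (hcol e) (hW f f.2).2
    have hdet : Tendsto (fun By => (Matrix.of fun e f : W =>
        invKasteleyn a b c Bx By e.1.black f.1.white).det) atTop (𝓝 M.det) := by
      have h1 : Tendsto (fun By => (Matrix.of fun e f : W =>
          invKasteleyn a b c Bx By e.1.black f.1.white)) atTop (𝓝 M) :=
        tendsto_pi_nhds.2 fun e => tendsto_pi_nhds.2 fun f => hentry e f
      exact ((continuous_id.matrix_det).tendsto M).comp h1
    -- `hdiag` determines the weights of the edges of `W`, so they do not depend on `By`
    have hconst : ∀ By, ∏ e ∈ W, (edgeWeight a b c Bx By e : ℂ) =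
        ∏ e ∈ W, (edgeWeight a b c Bx 0 e : ℂ) := by
      intro By
      refine Finset.prod_congr rfl fun e he => ?_
      have h1 := hdiag e.white By (hW e he).2
      have h2 := hdiag e.white 0 (hW e he).2
      rw [← hW' ⟨e, he⟩] at h1 h2
      have h3 : columnKernel a c Bx j e.black.2 e.white.2 ≠ 0 := right_ne_zero_of_mul_eq_one h1
      exact mul_right_cancel₀ h3 (h1.trans h2.symm)
    have hlim := hdet.const_mul (∏ e ∈ W, (edgeWeight a b c Bx 0 e : ℂ))
    have hone : (∏ e ∈ W, (edgeWeight a b c Bx 0 e : ℂ)) * M.det = 1 := by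
      rw [hMdet, ← Finset.prod_coe_sort W, ← Finset.prod_mul_distrib]
      refine Finset.prod_eq_one fun e _ => ?_
      have h1 := hdiag e.1.white 0 (hW e e.2).2
      rw [← hW' e] at h1
      have hb1 : e.1.black.1 = e.1.white.1 := by
        conv_lhs => rw [hW' e]
        exact hκ _
      simp only [hM, Matrix.of_apply, hb1, sub_self, if_true]
      exact h1
    rw [hone] at hlim
    refine hlim.congr fun By => ?_
    rw [localStat, hconst By]
  refine ⟨hstat, fun μ hμ => ⟨fun W hW => ?_, fun hBall => ?_⟩⟩
  · set S : Finset Edge := W.image fun v => ⟨v, κ⟩ with hS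
    have h1 := hstat S fun e he => by
      obtain ⟨v, hv, rfl⟩ := Finset.mem_image.1 he
      exact ⟨rfl, hW v hv⟩
    have hset : {C : DimerConfig | ∀ v ∈ W, (⟨v, κ⟩ : Edge) ∈ C.1} =
        {C : DimerConfig | ∀ e ∈ S, e ∈ C.1} := by
      ext C
      simp only [hS, Finset.forall_mem_image]
    have h2 : Tendsto (fun By => (μ By).real {C : DimerConfig | ∀ e ∈ S, e ∈ C.1}) atTop
        (𝓝 1) := by
      have h3 := (Complex.continuous_re.tendsto 1).comp h1
      rw [Complex.one_re] at h3
      refine h3.congr' ?_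
      filter_upwards [hμ] with By hBy
      rw [Function.comp_apply, ← hBy.local_statistics S, Complex.ofReal_re]
    have h4 := (ENNReal.continuous_ofReal.tendsto 1).comp h2
    rw [ENNReal.ofReal_one] at h4
    refine h4.congr' ?_
    filter_upwards [hμ] with By hBy
    have := hBy.isProbabilityMeasure
    rw [hset, Function.comp_apply, ofReal_measureReal]
  · refine tendsto_const_nhds.congr' ?_
    filter_upwards [hμ, eventually_invKasteleyn_eq (b := b) Bx ha hc hBall] with By hBy hK
    have := hBy.isProbabilityMeasure
    have hae : ∀ v : ℤ × ℤ, (v.1 : ZMod n) = j → ∀ᵐ C ∂(μ By), (⟨v, κ⟩ : Edge) ∈ C.1 := by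
      intro v hv
      have h1 := hBy.local_statistics {⟨v, κ⟩}
      have h2 : localStat a b c Bx By {⟨v, κ⟩} = 1 := by
        rw [localStat, Finset.prod_singleton, Matrix.det_unique, Matrix.of_apply]
        have h3 : ((default : ({⟨v, κ⟩} : Finset Edge)) : Edge) = ⟨v, κ⟩ := by
          simp
        rw [h3]
        have h4 := hK j v.1 (Edge.black ⟨v, κ⟩).2 v.2 hv
        have h5 : Edge.black ⟨v, κ⟩ = (v.1, (Edge.black ⟨v, κ⟩).2) := Prod.ext (hκ v) rfl
        rw [h5, show (⟨v, κ⟩ : Edge).white = (v.1, v.2) from rfl, h4]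
        exact hdiag v By hv
      rw [h2, Complex.ofReal_eq_one] at h1
      simp only [Finset.mem_singleton, forall_eq] at h1
      have h6 : μ By {C : DimerConfig | (⟨v, κ⟩ : Edge) ∈ C.1} = 1 := by
        rw [← ofReal_measureReal, h1, ENNReal.ofReal_one]
      exact (mem_ae_iff_prob_eq_one (measurableSet_mem_config _)).2 h6
    have hall : ∀ᵐ C ∂(μ By), ∀ v : ℤ × ℤ, (v.1 : ZMod n) = j → (⟨v, κ⟩ : Edge) ∈ C.1 := by
      rw [ae_all_iff]
      intro v
      by_cases hv : (v.1 : ZMod n) = j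
      · filter_upwards [hae v hv] with C hC _ using hC
      · exact Eventually.of_forall fun C h => absurd h hv
    have h7 := measure_congr (eventuallyEq_univ.2 hall)
    rw [measure_univ] at h7
    exact h7.symm

end Filled

end HoneycombDimer

theorem mainTheorem6 (m n : ℕ) [NeZero m] [NeZero n] (a b c : ZMod m → ZMod n → ℝ)
    (ha : ∀ i j, 0 < a i j) (hb : ∀ i j, 0 < b i j) (hc : ∀ i j, 0 < c i j)
    (Bx : ℝ) (j₀ : ZMod n) :
    (Bx < ∑ i : ZMod m, Real.log (a i j₀ / c i j₀) →
      HoneycombDimer.ColumnsFilled a b c Bx j₀ HoneycombDimer.EdgeType.a) ∧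
    (∑ i : ZMod m, Real.log (a i j₀ / c i j₀) < Bx →
      HoneycombDimer.ColumnsFilled a b c Bx j₀ HoneycombDimer.EdgeType.c) := by
  open HoneycombDimer in
  constructor
  · intro h
    have h' : Bx < threshold a c j₀ := h
    refine columnsFilled_of_kernel ha hb hc h'.ne (fun v => rfl) ?_ id Function.injective_id
      fun v v' hv => columnKernel_eq_zero_of_lt Bx ha hc h' hv
    intro v By hv
    have h1 := columnKernel_rec Bx ha hc h'.ne v.2 v.2
    rw [columnKernel_eq_zero_of_lt Bx ha hc h' (sub_one_lt v.2), mul_zero, add_zero, if_pos rfl] at h1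
    simpa [edgeWeight, vertexType, Edge.black, hv] using h1
  · intro h
    have h' : threshold a c j₀ < Bx := h
    refine columnsFilled_of_kernel ha hb hc h'.ne' (fun v => rfl) ?_ (fun Y => -Y) neg_injective
      fun v v' hv => columnKernel_eq_zero_of_ge Bx ha hc h' ?_
    · intro v By hv
      have h1 := columnKernel_rec Bx ha hc h'.ne' v.2 v.2
      rw [columnKernel_eq_zero_of_ge Bx ha hc h' le_rfl, mul_zero, zero_add, if_pos rfl,
        cWeight] at h1
      simp only [edgeWeight, vertexType, Edge.black, hv]
      exact h1
    · simp only [Edge.black]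
      omega
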